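/- Let $\mathcal C$ and $\mathcal D$ be rigidly-compactly generated tensor-triangulated categories: triangulated categories with a compatible closed symmetric monoidal structure (tensor $\otimes$, internal hom $[-,-]$, unit $\mathbb 1$), with arbitrary coproducts, generated by a set of compact objects, and whose compact objects are exactly the rigid ones. Write $\mathcal C^c$, $\mathcal D^c$ for the full subcategories of compact objects. Let $f^*\colon\mathcal D\to\mathcal C$ be a strong symmetric monoidal triangulated functor which preserves arbitrary coproducts. Then there are adjoints $f^*\dashv f_*\dashv f^{(1)}$. For any choice of them put $\omega:=f^{(1)}(\mathbb 1_{\mathcal D})$ and $D:=[-,\mathbb 1_{\mathcal D}]$; the Hom-objects of $\mathcal C$ as a $\mathcal D$-enriched category are $f_*[x,y]$. (1) (Relative Serre duality) There is a canonical isomorphism in $\mathcal D$ $$\sigma_{x,y}\colon D(f_*[x,y])\;\xrightarrow{\ \sim\ }\;f_*[y,x\otimes\omega],\qquad x\in\mathcal C^c,\ y\in\mathcal C,$$ natural in $x$ and $y$. Here "canonical" means that $\sigma$ is the unique natural isomorphism such that, for all $x\in\mathcal C^c$ and $y\in\mathcal C$, the composite $$f_*(x\otimes[y,\omega])\to f_*[[x,y],\omega]\to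 D(f_*[x,y])\xrightarrow{\ \sigma_{x,y}\ } f_*[y,x\otimes\omega]$$ is the image under $f_*$ of the standard map $x\otimes[y,\omega]\to[y,x\otimes\omega]$. The first map is induced by double evaluation. The second is adjoint to $f_*z\otimes f_*[z,\omega]\to f_*(z\otimes[z,\omega])\to f_*\omega\to\mathbb 1_{\mathcal D}$ with $z=[x,y]$, the last arrow being the counit of $f_*\dashv f^{(1)}$. (2) (Relative Serre functor) Assume that we are in the situation of the Wirthmüller isomorphism, that is: either $f_*$ preserves compact objects (Grothendieck–Neeman duality) and $\omega$ is $\otimes$-invertible, or $f^*$ has a left adjoint isomorphic to $f_*(l\otimes-)$ for some $\otimes$-invertible object $l\in\mathcal C$. Then $\mathbb S:=-\otimes\omega$ restricts to an equivalence $\mathcal C^c\xrightarrow{\sim}\mathcal C^c$, and $f_*[x,y]\in\mathcal D^c$ for all $x,y\in\mathcal C^c$. So $\mathbb S$, with the canonical natural isomorphism $\sigma_{x,y}\colon D(f_*[x,y])\cong f_*[y,\mathbb Sx]$ for $x,y\in\mathcal C^c$, is a Serre functor on $\mathcal C^c$ relative to $\mathcal D^c$. (3) (Serre duality over a field) Assume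 in addition that $\mathcal D$ is the derived category $\mathrm D(k)$ of a field $k$; it is enough that there is a triangulated equivalence $\mathcal D\simeq\mathrm D(k)$ which sends $\mathbb 1_{\mathcal D}$ to $k$ in degree $0$. Then $\mathcal C^c$ is $k$-linear through $k\cong\operatorname{End}(\mathbb 1_{\mathcal D})\to\operatorname{End}(\mathbb 1_{\mathcal C})$, its Hom-spaces are finite-dimensional, and $\mathbb S=-\otimes\omega$ is a Serre functor on it: $\mathbb S$ is a $k$-linear self-equivalence and there are $k$-linear isomorphisms $\operatorname{Hom}_k(\mathcal C(x,y),k)\cong\mathcal C(y,\mathbb Sx)$ natural in $x,y\in\mathcal C^c$. -/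

import Mathlib

open CategoryTheory CategoryTheory.Limits CategoryTheory.MonoidalCategory
open CategoryTheory.Pretriangulated Opposite

universe v u₁ u₂ w

noncomputable section

/-! ### Tensor-triangulated categories -/

section TensorTriangulated

variable (C : Type u₁) [Category.{v} C] [Preadditive C] [HasZeroObject C] [HasShift C ℤ]
  [∀ n : ℤ, (shiftFunctor C n).Additive] [MonoidalCategory C] [SymmetricCategory C]
  [MonoidalClosed C]

/-- The map `Σ [Σ X, W] ⟶ [X, W]` induced by a suspension isomorphism
`e : Σ X ⊗ Y ≅ Σ (X ⊗ Y)`: it is adjoint to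
`X ⊗ Σ [Σ X, W] ≅ Σ [Σ X, W] ⊗ X ≅ Σ ([Σ X, W] ⊗ X) ≅ Σ (X ⊗ [Σ X, W]) ≅ Σ X ⊗ [Σ X, W] ⟶ W`. -/
def ihomShiftMap (e : ∀ X Y : C, X⟦(1 : ℤ)⟧ ⊗ Y ≅ (X ⊗ Y)⟦(1 : ℤ)⟧) (X W : C) :
    ((ihom (X⟦(1 : ℤ)⟧)).obj W)⟦(1 : ℤ)⟧ ⟶ (ihom X).obj W :=
  MonoidalClosed.curry
    ((β_ X (((ihom (X⟦(1 : ℤ)⟧)).obj W)⟦(1 : ℤ)⟧)).hom ≫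
      (e ((ihom (X⟦(1 : ℤ)⟧)).obj W) X).hom ≫
      ((β_ ((ihom (X⟦(1 : ℤ)⟧)).obj W) X).hom)⟦(1 : ℤ)⟧' ≫
      (e X ((ihom (X⟦(1 : ℤ)⟧)).obj W)).inv ≫
      (ihom.ev (X⟦(1 : ℤ)⟧)).app W)

/-- A closed symmetric monoidal structure on a triangulated category which is compatible with
the triangulation, in the sense of Hovey, Palmieri and Strickland.
(Exactness of `[W, -]` is automatic, as it is right adjoint to the exact functor `W ⊗ -`.) -/
class TensorTriangulated [Pretriangulated C] where
  /-- the suspension isomorphism `Σ X ⊗ Y ≅ Σ (X ⊗ Y)` -/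
  e (X Y : C) : X⟦(1 : ℤ)⟧ ⊗ Y ≅ (X ⊗ Y)⟦(1 : ℤ)⟧
  e_natural {X X' Y Y' : C} (a : X ⟶ X') (b : Y ⟶ Y') :
    ((a⟦(1 : ℤ)⟧') ⊗ₘ b) ≫ (e X' Y').hom = (e X Y).hom ≫ (a ⊗ₘ b)⟦(1 : ℤ)⟧'
  e_unit (X : C) : (e X (𝟙_ C)).hom ≫ ((ρ_ X).hom)⟦(1 : ℤ)⟧' = (ρ_ (X⟦(1 : ℤ)⟧)).hom
  e_assoc (X Y Z : C) :
    ((e X Y).hom ▷ Z) ≫ (e (X ⊗ Y) Z).hom ≫ ((α_ X Y Z).hom)⟦(1 : ℤ)⟧' =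
      (α_ (X⟦(1 : ℤ)⟧) Y Z).hom ≫ (e X (Y ⊗ Z)).hom
  /-- the tensor product is exact -/
  tensor_exact (T : Triangle C) (hT : T ∈ distTriang C) (W : C) :
    Triangle.mk (T.mor₁ ▷ W) (T.mor₂ ▷ W) (T.mor₃ ▷ W ≫ (e T.obj₁ W).hom) ∈ distTriang C
  /-- `[-, W]` is exact up to sign: for `X ⟶ Y ⟶ Z ⟶ Σ X` exact, so is
  `[Σ X, W] ⟶ [Z, W] ⟶ [Y, W] ⟶ [X, W] ≅ Σ [Σ X, W]`, with a sign on the first map -/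
  ihom_exact (T : Triangle C) (hT : T ∈ distTriang C) (W : C) :
    ∃ δ : (ihom T.obj₂).obj W ⟶ ((ihom (T.obj₁⟦(1 : ℤ)⟧)).obj W)⟦(1 : ℤ)⟧,
      δ ≫ ihomShiftMap C e T.obj₁ W = (MonoidalClosed.pre T.mor₁).app W ∧
      Triangle.mk (-(MonoidalClosed.pre T.mor₃).app W) ((MonoidalClosed.pre T.mor₂).app W) δ
        ∈ distTriang C
  /-- the tensor product and the suspension interact in a graded-commutative manner:
  the twist of `Σ 𝟙 ⊗ Σ 𝟙` is `-1` -/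
  braiding_shift_unit :
    (β_ ((𝟙_ C)⟦(1 : ℤ)⟧) ((𝟙_ C)⟦(1 : ℤ)⟧)).hom = -𝟙 _

end TensorTriangulated

/-! ### Compact objects, rigid objects, rigidly-compactly generated categories -/

/-- The compact objects `x`: those for which `C(x, -) : C ⥤ Ab` preserves coproducts. -/
def compactObjects (C : Type u₁) [Category.{v} C] [Preadditive C] : ObjectProperty C :=
  fun x => ∀ J : Type v,
    PreservesColimitsOfShape (Discrete J) (preadditiveCoyoneda.obj (op x))

/-- The full subcategory `Cᶜ` of compact objects. -/
abbrev CompactSubcategory (C : Type u₁) [Category.{v} C] [Preadditive C] :=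
  (compactObjects C).FullSubcategory

/-- There are small coproducts and a small set of compact objects `G` such that an object `t`
with `C(g, t) = 0` for all `g ∈ G` is zero. -/
def IsCompactlyGeneratedCategory (C : Type u₁) [Category.{v} C] [Preadditive C] : Prop :=
  HasCoproducts.{v} C ∧
    ∃ G : ObjectProperty C, ObjectProperty.Small.{v} G ∧ G ≤ compactObjects C ∧
      ∀ t : C, (∀ g : C, G g → ∀ a : g ⟶ t, a = 0) → IsZero t

section Closed

variable {C : Type u₁} [Category.{v} C] [MonoidalCategory C] [SymmetricCategory C]
  [MonoidalClosed C]

/-- The natural map `[x, 𝟙] ⊗ y ⟶ [x, y]`. -/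
def rigidityMap (x y : C) : (ihom x).obj (𝟙_ C) ⊗ y ⟶ (ihom x).obj y :=
  MonoidalClosed.curry
    ((α_ x ((ihom x).obj (𝟙_ C)) y).inv ≫ ((ihom.ev x).app (𝟙_ C)) ▷ y ≫ (λ_ y).hom)

/-- The object `x` is rigid: `[x, 𝟙] ⊗ y ⟶ [x, y]` is an isomorphism for all `y`. -/
def IsRigidObject (x : C) : Prop := ∀ y : C, IsIso (rigidityMap x y)

/-- The object `x` is `⊗`-invertible. -/
def IsTensorInvertible (x : C) : Prop := ∃ x' : C, Nonempty (x ⊗ x' ≅ 𝟙_ C)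

/-- The map `x ⊗ [y, w] ⟶ [[x, y], w]` adjoint to
`[x, y] ⊗ (x ⊗ [y, w]) ⟶ y ⊗ [y, w] ⟶ w` (evaluate twice). -/
def doubleHomMap (x y w : C) :
    x ⊗ (ihom y).obj w ⟶ (ihom ((ihom x).obj y)).obj w :=
  MonoidalClosed.curry
    ((α_ ((ihom x).obj y) x ((ihom y).obj w)).inv ≫
      ((β_ ((ihom x).obj y) x).hom ≫ (ihom.ev x).app y) ▷ ((ihom y).obj w) ≫
      (ihom.ev y).app w)

/-- The map `x ⊗ [y, w] ⟶ [y, x ⊗ w]` adjoint to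
`y ⊗ (x ⊗ [y, w]) ≅ x ⊗ (y ⊗ [y, w]) ⟶ x ⊗ w`. -/
def tensorHomMap (x y w : C) :
    x ⊗ (ihom y).obj w ⟶ (ihom y).obj (x ⊗ w) :=
  MonoidalClosed.curry
    ((α_ y x ((ihom y).obj w)).inv ≫ (β_ y x).hom ▷ ((ihom y).obj w) ≫
      (α_ x y ((ihom y).obj w)).hom ≫ x ◁ (ihom.ev y).app w)

end Closed

/-- A tensor-triangulated category is rigidly-compactly generated if it is compactly generated
and its compact objects are exactly its rigid objects. -/
class RigidlyCompactlyGenerated (C : Type u₁) [Category.{v} C] [Preadditive C]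
    [MonoidalCategory C] [SymmetricCategory C] [MonoidalClosed C] : Prop where
  compactlyGenerated : IsCompactlyGeneratedCategory C
  compact_iff_rigid (x : C) : compactObjects C x ↔ IsRigidObject x

/-! ### Hom-objects in `D` and the two sides of Serre duality -/

section Serre

variable {C : Type u₁} [Category.{v} C] [MonoidalCategory C] [SymmetricCategory C]
  [MonoidalClosed C]
  {D : Type u₂} [Category.{v} D] [MonoidalCategory D] [SymmetricCategory D] [MonoidalClosed D]

/-- For `R = f_*`, the Hom-object `R [x, y]` in `D` of the `D`-enrichment of `C`. -/
abbrev richHom (R : C ⥤ D) (x y : C) : D := R.obj ((ihom x).obj y)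

/-- The dual `[d, 𝟙]`. -/
abbrev tensorDual (d : D) : D := (ihom d).obj (𝟙_ D)

/-- The functor `(x, y) ↦ [R [x, y], 𝟙]`, covariant in `x` and contravariant in `y`. -/
def dualRichHom (R : C ⥤ D) : C ⥤ Cᵒᵖ ⥤ D where
  obj x :=
    { obj := fun y => tensorDual (richHom R x y.unop)
      map := fun b => (MonoidalClosed.pre (R.map ((ihom x).map b.unop))).app (𝟙_ D)
      map_id := fun y => by simp
      map_comp := fun a b => by simp }
  map a :=
    { app := fun y =>
        (MonoidalClosed.pre (R.map ((MonoidalClosed.pre a).app y.unop))).app (𝟙_ D)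
      naturality := fun y y' b => by
        simp only [← NatTrans.comp_app, ← MonoidalClosed.pre_map, ← R.map_comp,
          NatTrans.naturality] }
  map_id x := by ext; simp
  map_comp a b := by ext; simp

/-- For `S : A ⥤ C`, the functor `(x, y) ↦ R [y, S x]`, covariant in `x` and contravariant
in `y`. -/
def richHomInto (R : C ⥤ D) {A : Type*} [Category* A] (S : A ⥤ C) : A ⥤ Cᵒᵖ ⥤ D where
  obj x :=
    { obj := fun y => richHom R y.unop (S.obj x)
      map := fun b => R.map ((MonoidalClosed.pre b.unop).app (S.obj x))
      map_id := fun y => by simp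
      map_comp := fun a b => by simp }
  map a :=
    { app := fun y => R.map ((ihom y.unop).map (S.map a))
      naturality := fun y y' b => by
        simp only [← R.map_comp, NatTrans.naturality] }
  map_id x := by ext; simp
  map_comp a b := by ext; simp

variable {F : D ⥤ C} [F.Monoidal] {R : C ⥤ D} {G : D ⥤ C}

/-- The relative dualizing object `ω = f^{(1)}(𝟙)`, for `G = f^{(1)}`. -/
abbrev dualizingObject (G : D ⥤ C) : C := G.obj (𝟙_ D)

/-- For `F ⊣ R ⊣ G`, the map `R [z, ω] ⟶ [R z, 𝟙]` adjoint to
`R z ⊗ R [z, ω] ⟶ R (z ⊗ [z, ω]) ⟶ R ω ⟶ 𝟙`, where the first map is the lax monoidal structure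
of the right adjoint `R` of `F` and the last one is the counit of `R ⊣ G`. -/
def dualizingMap (adj : F ⊣ R) (adj' : R ⊣ G) (z : C) :
    R.obj ((ihom z).obj (dualizingObject G)) ⟶ tensorDual (R.obj z) :=
  letI := adj.rightAdjointLaxMonoidal
  MonoidalClosed.curry
    (Functor.LaxMonoidal.μ R z ((ihom z).obj (dualizingObject G)) ≫
      R.map ((ihom.ev z).app (dualizingObject G)) ≫ adj'.counit.app (𝟙_ D))

/-- A map `s : [R [x, y], 𝟙] ⟶ R [y, x ⊗ ω]` is the canonical one if it is compatible with
the canonical maps from `R (x ⊗ [y, ω])` to its source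
(`R (x ⊗ [y, ω]) ⟶ R [[x, y], ω] ⟶ [R [x, y], 𝟙]`) and to its target. -/
def IsCanonicalSerreMap (adj : F ⊣ R) (adj' : R ⊣ G) (x y : C)
    (s : tensorDual (richHom R x y) ⟶ richHom R y (x ⊗ dualizingObject G)) : Prop :=
  R.map (doubleHomMap x y (dualizingObject G)) ≫ dualizingMap adj adj' ((ihom x).obj y) ≫ s =
    R.map (tensorHomMap x y (dualizingObject G))

variable [Preadditive C] [Preadditive D]

/-- `S` is a Serre functor on `Cᶜ` relative to `Dᶜ`: it is a self-equivalence of `Cᶜ`, the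
Hom-objects `R [x, y]` for `x, y ∈ Cᶜ` lie in `Dᶜ`, and there is a given isomorphism
`[R [x, y], 𝟙] ≅ R [y, S x]` natural in `x, y ∈ Cᶜ`. -/
structure RelativeSerreFunctor (R : C ⥤ D) (S : CompactSubcategory C ⥤ CompactSubcategory C) where
  isEquivalence : S.IsEquivalence
  richHom_compact (x y : CompactSubcategory C) : compactObjects D (richHom R x.obj y.obj)
  /-- the duality isomorphism -/
  σ : (compactObjects C).ι ⋙ dualRichHom R ⋙
        (Functor.whiskeringLeft _ _ D).obj (compactObjects C).ι.op ≅
      richHomInto R (S ⋙ (compactObjects C).ι) ⋙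
        (Functor.whiskeringLeft _ _ D).obj (compactObjects C).ι.op

/-- The restriction of `- ⊗ w` to the compact objects. -/
def tensorOnCompacts (w : C) (hw : ∀ x : C, compactObjects C x → compactObjects C (x ⊗ w)) :
    CompactSubcategory C ⥤ CompactSubcategory C :=
  (compactObjects C).lift ((compactObjects C).ι ⋙ tensorRight w)
    (fun x => hw x.obj x.property)

/-- The situation of the Wirthmüller isomorphism. Either
* Grothendieck–Neeman duality holds in the form of Neeman's criterion (`R = f_*` preserves compact
  objects) and the relative dualizing object is `⊗`-invertible, or
* `F = f^*` has a left adjoint of the form `f_*(l ⊗ -)`, for some `⊗`-invertible object `l`. -/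
def WirthmuellerSituation (F : D ⥤ C) (R : C ⥤ D) (G : D ⥤ C) : Prop :=
  ((∀ x : C, compactObjects C x → compactObjects D (R.obj x)) ∧
      IsTensorInvertible (dualizingObject G)) ∨
    ∃ L : C ⥤ D, Nonempty (L ⊣ F) ∧
      ∃ l : C, IsTensorInvertible l ∧ Nonempty (L ≅ tensorLeft l ⋙ R)

end Serre

/-! ### Serre functors over a field -/

/-- `S` is a Serre functor on the `k`-linear category `A`: it is a `k`-linear self-equivalence,
the `k`-vector spaces `A(x, y)` are finite-dimensional, and there are given `k`-linear isomorphisms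
`A(x, y)^* ≅ A(y, S x)`, natural in `x` and `y`. -/
structure SerreFunctor (k : Type*) [Field k] {A : Type*} [Category* A] [Preadditive A]
    [Linear k A] (S : A ⥤ A) where
  isEquivalence : S.IsEquivalence
  additive : S.Additive
  linear : S.Linear k
  finite (x y : A) : Module.Finite k (x ⟶ y)
  /-- the duality isomorphism -/
  σ (x y : A) : Module.Dual k (x ⟶ y) ≃ₗ[k] (y ⟶ S.obj x)
  naturality_left {x x' : A} (a : x ⟶ x') (y : A) (φ : Module.Dual k (x ⟶ y)) :
    σ x' y (φ ∘ₗ Linear.leftComp k y a) = σ x y φ ≫ S.map a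
  naturality_right (x : A) {y y' : A} (b : y ⟶ y') (φ : Module.Dual k (x ⟶ y')) :
    σ x y (φ ∘ₗ Linear.rightComp k x b) = b ≫ σ x y' φ

section Linear

variable {C : Type u₁} [Category.{v} C] [Preadditive C] [MonoidalCategory C]
  {D : Type u₂} [Category.{v} D] [Preadditive D] [MonoidalCategory D]

/-- The action of `End(𝟙)` on a preadditive monoidal category by natural endomorphisms of the
identity functor: `t` acts on `X` by `X ≅ 𝟙 ⊗ X ⟶ 𝟙 ⊗ X ≅ X`, using `t ⊗ X`. -/
def endUnitToCatCenter [MonoidalPreadditive C] : End (𝟙_ C) →+* CatCenter C where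
  toFun t :=
    { app := fun X => (λ_ X).inv ≫ (show 𝟙_ C ⟶ 𝟙_ C from t) ▷ X ≫ (λ_ X).hom
      naturality := fun X Y g => by
        dsimp only [Functor.id_obj, Functor.id_map]
        rw [leftUnitor_inv_naturality_assoc, whisker_exchange_assoc, leftUnitor_naturality,
          Category.assoc, Category.assoc] }
  map_one' := CatCenter.ext _ _ (fun X => by simp [End.one_def])
  map_mul' s t := CatCenter.ext _ _ (fun X => by
    rw [CatCenter.mul_app']
    simp [CatCenter.app, End.mul_def])
  map_zero' := CatCenter.ext _ _ (fun X => by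
    simp only [CatCenter.app]
    erw [MonoidalPreadditive.zero_whiskerRight]
    simp)
  map_add' s t := CatCenter.ext _ _ (fun X => by
    simp only [CatCenter.app]
    erw [MonoidalPreadditive.add_whiskerRight]
    simp)

/-- The ring morphism `End(𝟙_D) ⟶ End(𝟙_C)` induced by an additive monoidal functor. -/
def endUnitMap (F : D ⥤ C) [F.Monoidal] [F.Additive] : End (𝟙_ D) →+* End (𝟙_ C) where
  toFun t := Functor.LaxMonoidal.ε F ≫ F.map t ≫ Functor.OplaxMonoidal.η F
  map_one' := by
    have h : F.map (1 : End (𝟙_ D)) = 𝟙 _ := F.map_id _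
    rw [h]; simp [End.one_def]
  map_mul' s t := by
    have h : F.map (s * t) = F.map t ≫ F.map s := F.map_comp t s
    rw [h]; simp [End.mul_def]
  map_zero' := by
    have h : F.map (0 : End (𝟙_ D)) = 0 := F.map_zero _ _
    rw [h]; simp
  map_add' s t := by
    have h : F.map (s + t) = F.map s + F.map t := F.map_add
    rw [h]; simp

variable (k : Type v) [Field k] [HasDerivedCategory.{w} (ModuleCat.{v} k)]

/-- The field `k`, as an object of its derived category, in degree `0`. -/
abbrev derivedUnit : DerivedCategory (ModuleCat.{v} k) :=
  (DerivedCategory.singleFunctor (ModuleCat.{v} k) 0).obj (ModuleCat.of k k)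

variable {k}

/-- The action of the field `k` on the unit of `D`, for an equivalence `E : D ≌ D(k)` which sends
the unit to `k`. -/
def scalarsToEndUnit (E : D ⥤ DerivedCategory (ModuleCat.{v} k)) [E.IsEquivalence] [E.Additive]
    (ι : E.obj (𝟙_ D) ≅ derivedUnit k) : k →+* End (𝟙_ D) where
  toFun a := E.preimage (ι.hom ≫
    (DerivedCategory.singleFunctor (ModuleCat.{v} k) 0).map (a • 𝟙 (ModuleCat.of k k)) ≫ ι.inv)
  map_one' := E.map_injective (by simp [End.one_def])
  map_mul' a b := E.map_injective (by
    simp [End.mul_def, smul_smul])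
  map_zero' := E.map_injective (by simp)
  map_add' a b := E.map_injective (by
    have h (s t : End (𝟙_ D)) : E.map (s + t) = E.map s + E.map t := E.map_add
    rw [h]; simp [add_smul])

/-- The `k`-linear structure on `C` induced by `F : D ⥤ C` if `D = D(k)`: a scalar acts on
`C` through `k = End(𝟙_D) ⟶ End(𝟙_C)`. -/
abbrev inducedLinear [MonoidalPreadditive C] (F : D ⥤ C) [F.Monoidal] [F.Additive]
    (E : D ⥤ DerivedCategory (ModuleCat.{v} k)) [E.IsEquivalence] [E.Additive]
    (ι : E.obj (𝟙_ D) ≅ derivedUnit k) : Linear k C :=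
  Linear.ofRingMorphism
    ((endUnitToCatCenter.comp (endUnitMap F)).comp (scalarsToEndUnit E ι))

end Linear

end

/-! Write `R = f_*`, `G = f^{(1)}`, `ω = G 𝟙`. The heart is a Yoneda argument on dualizable test
objects. If `d` in `D` has a dual, the projection formula `R z ⊗ d ≅ R (z ⊗ F d)` is formal, and
adjunctions give `D(d, R [z, ω]) ≅ C(z ⊗ F d, ω) ≅ D(R (z ⊗ F d), 𝟙) ≅ D(R z ⊗ d, 𝟙) ≅ D(d, [R z,
𝟙])`. The composite is composition with `dualizingMap` (`bijective_comp_dualizingMap`). The compact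
generators of `D` are rigid, so `dualizingMap` is an isomorphism for every `z`
(`isIso_dualizingMap`).

Take `z = [x, y]` with `x` rigid. Then `x ⊗ [y, ω] ⟶ [[x, y], ω]` and `x ⊗ [y, ω] ⟶ [y, x ⊗ ω]` are
isomorphisms too (`isIso_doubleHomMap`, `isIso_tensorHomMap`). The canonicity condition now reads `m
≫ s = n` with `m` invertible, so it forces `s = m⁻¹ ≫ n`; this gives existence and uniqueness at
once, and naturality is that of `m` and `n`.

The adjoints come from Brown representability, applied twice: `F` preserves rigid objects, hence
compact ones, so `R` preserves coproducts and has a right adjoint itself. In the second Wirthmüller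
case, uniqueness of adjoints yields `l ≅ ω`, and `R x ≅ L (l⁻¹ ⊗ x)` is compact for compact `x`.

Over a field, `𝟙` represents `d ↦ Hom_k(D(𝟙, d), k)`: this functor is cohomological, so it is enough
to look at the shifts of `𝟙` (`bijective_dual_comp`). Hence the dual of `C(x, y) ≅ D(𝟙, R [x, y])`
is `D(R [x, y], 𝟙) ≅ D(𝟙, [R [x, y], 𝟙])`, which relative duality turns into `C(y, x ⊗ ω)`. The same
duality, used twice on a rigid object, identifies a Hom-space with its bidual, and this forces
finite dimension. -/

noncomputable section

/-! ### Compact objects -/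

section Compact

variable {T : Type u₁} [Category.{v} T] [Preadditive T]

/-- A morphism from a compact object to a coproduct is a finite sum of morphisms which factor
through the summands. -/
lemma compactObjects.mem_closure {x : T} (hx : compactObjects T x) {J : Type v} (X : J → T)
    [HasCoproduct X] (f : x ⟶ ∐ X) :
    f ∈ AddSubgroup.closure {h | ∃ (j : J) (a : x ⟶ X j), h = a ≫ Sigma.ι X j} := by
  let K := preadditiveCoyoneda.obj (op x)
  let S : AddSubgroup (x ⟶ ∐ X) :=
    AddSubgroup.closure {h | ∃ (j : J) (a : x ⟶ X j), h = a ≫ Sigma.ι X j}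
  have := hx J
  let q : K.obj (∐ X) ⟶ AddCommGrpCat.of ((x ⟶ ∐ X) ⧸ S) :=
    AddCommGrpCat.ofHom (QuotientAddGroup.mk' S)
  have hq : q = 0 := by
    refine (isColimitOfPreserves K (colimit.isColimit (Discrete.functor X))).hom_ext ?_
    rintro ⟨j⟩
    ext a
    exact (QuotientAddGroup.eq_zero_iff _).2 (AddSubgroup.subset_closure ⟨j, a, rfl⟩)
  have h := ConcreteCategory.congr_hom hq f
  exact (QuotientAddGroup.eq_zero_iff _).1 h

lemma compactObjects.of_natIso {A : Type u₁} [Category.{v} A] [Preadditive A]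
    {B : Type u₂} [Category.{v} B] [Preadditive B] {x : A} {y : B} (hx : compactObjects A x)
    (S : B ⥤ A) (hS : ∀ J : Type v, PreservesColimitsOfShape (Discrete J) S)
    (i : S ⋙ preadditiveCoyoneda.obj (op x) ≅ preadditiveCoyoneda.obj (op y)) :
    compactObjects B y := fun J => by
  have := hx J
  have := hS J
  exact preservesColimitsOfShape_of_natIso i

/-- A left adjoint of a coproduct-preserving additive functor preserves compact objects. -/
lemma compactObjects.leftAdjoint_obj {A : Type u₁} [Category.{v} A] [Preadditive A]
    {B : Type u₂} [Category.{v} B] [Preadditive B] {L : A ⥤ B} {S : B ⥤ A} [S.Additive]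
    (adj : L ⊣ S) (hS : ∀ J : Type v, PreservesColimitsOfShape (Discrete J) S) {x : A}
    (hx : compactObjects A x) : compactObjects B (L.obj x) :=
  hx.of_natIso S hS (NatIso.ofComponents (fun b => AddEquiv.toAddCommGrpIso
    (AddEquiv.mk' (adj.homEquiv x b) (fun f g => by
      simp [Adjunction.homEquiv_unit, S.map_add])).symm) (fun f => by
        ext a
        exact adj.homEquiv_naturality_right_symm a f))

lemma compactObjects.of_iso {x y : T} (hx : compactObjects T x) (i : x ≅ y) :
    compactObjects T y := fun J => by
  have := hx J
  exact preservesColimitsOfShape_of_natIso (preadditiveCoyoneda.mapIso i.symm.op)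

lemma compactObjects.shift [HasShift T ℤ] [∀ n : ℤ, (shiftFunctor T n).Additive] {x : T}
    (hx : compactObjects T x) (n : ℤ) : compactObjects T (x⟦n⟧) :=
  have : (shiftEquiv T n).inverse.Additive := inferInstanceAs (shiftFunctor T (-n)).Additive
  hx.leftAdjoint_obj (shiftEquiv T n).toAdjunction
    (fun J => inferInstanceAs (PreservesColimitsOfShape (Discrete J) (shiftFunctor T (-n))))

end Compact

/-! ### Brown representability -/

section Presheaf

variable {T : Type u₁} [Category.{v} T]

lemma presheaf_map_comp (H : Tᵒᵖ ⥤ AddCommGrpCat.{v}) {X Y Z : T} (f : X ⟶ Y) (h : Y ⟶ Z)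
    (u : H.obj (op Z)) : H.map (f ≫ h).op u = H.map f.op (H.map h.op u) := by
  rw [op_comp, H.map_comp, ConcreteCategory.comp_apply]

/-- Connecting morphisms land in a shift; desuspending them lets hypotheses on maps out of compact
objects apply. -/
lemma exists_eq_comp_shift_map [HasShift T ℤ] {x y : T} (e : y ≅ x⟦(-1 : ℤ)⟧) {Z : T}
    (a : x ⟶ Z⟦(1 : ℤ)⟧) :
    ∃ (e' : x ≅ y⟦(1 : ℤ)⟧) (b : y ⟶ Z), a = e'.hom ≫ b⟦(1 : ℤ)⟧' := by
  let e' : x ≅ y⟦(1 : ℤ)⟧ :=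
    ((shiftFunctor T (1 : ℤ)).mapIso e ≪≫ (shiftEquiv T (1 : ℤ)).counitIso.app x).symm
  obtain ⟨b, hb⟩ := (shiftFunctor T (1 : ℤ)).map_surjective (e'.inv ≫ a)
  exact ⟨e', b, by rw [hb, e'.hom_inv_id_assoc]⟩

variable [Preadditive T] (H : Tᵒᵖ ⥤ AddCommGrpCat.{v}) [H.Additive]

lemma presheaf_map_sub {X Y : T} (f h : X ⟶ Y) (u : H.obj (op Y)) :
    H.map (f - h).op u = H.map f.op u - H.map h.op u := by
  rw [op_sub, H.map_sub]; rfl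

end Presheaf

section Brown

variable {T : Type u₁} [Category.{v} T] [Preadditive T] [HasZeroObject T] [HasShift T ℤ]
  [∀ n : ℤ, (shiftFunctor T n).Additive] [Pretriangulated T]

/-- A family of compact generators, closed under desuspension. -/
structure IsCompactGeneratingFamily {I : Type v} (g : I → T) : Prop where
  compact (i : I) : compactObjects T (g i)
  desuspension (i : I) : ∃ j, Nonempty (g j ≅ (g i)⟦(-1 : ℤ)⟧)
  isZero (t : T) (ht : ∀ (i : I) (a : g i ⟶ t), a = 0) : IsZero t

/-- A contravariant functor to abelian groups is cohomological and takes coproducts to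
products. -/
structure IsCohomological (H : Tᵒᵖ ⥤ AddCommGrpCat.{v}) : Prop where
  exact (Δ : Triangle T) (hΔ : Δ ∈ distTriang T) (u : H.obj (op Δ.obj₂))
    (hu : H.map Δ.mor₁.op u = 0) : ∃ w : H.obj (op Δ.obj₃), H.map Δ.mor₂.op w = u
  coproduct {J : Type v} (X : J → T) [HasCoproduct X] (h : ∀ j, H.obj (op (X j))) :
    ∃! u : H.obj (op (∐ X)), ∀ j, H.map (Sigma.ι X j).op u = h j

/-- A cofiber of a morphism, with the consequences of exactness. -/
lemma exists_cofiber {X Y : T} (f : X ⟶ Y) :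
    ∃ (Z : T) (q : Y ⟶ Z) (δ : Z ⟶ X⟦(1 : ℤ)⟧), f ≫ q = 0 ∧ δ ≫ f⟦(1 : ℤ)⟧' = 0 ∧
      (IsZero Z → IsIso f) ∧
      (∀ (W : T) (a : W ⟶ Z), a ≫ δ = 0 → ∃ b, a = b ≫ q) ∧
      (∀ (H : Tᵒᵖ ⥤ AddCommGrpCat.{v}) (_ : IsCohomological H) (u : H.obj (op Y)),
        H.map f.op u = 0 → ∃ w : H.obj (op Z), H.map q.op w = u) := by
  obtain ⟨Z, q, δ, hΔ⟩ := distinguished_cocone_triangle f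
  exact ⟨Z, q, δ, comp_distTriang_mor_zero₁₂ _ hΔ, comp_distTriang_mor_zero₃₁ _ hΔ,
    (Triangle.isZero₃_iff_isIso₁ _ hΔ).1, fun W a ha => Triangle.coyoneda_exact₃ _ hΔ a ha,
    fun H hH u hu => hH.exact _ hΔ u hu⟩

variable {I : Type v} {g : I → T}

/-- A morphism which induces bijections on morphisms from the generators is an isomorphism. -/
lemma IsCompactGeneratingFamily.isIso (hg : IsCompactGeneratingFamily g) {X Y : T} (f : X ⟶ Y)
    (hf : ∀ (i : I), Function.Bijective (fun a : g i ⟶ X => a ≫ f)) : IsIso f := by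
  obtain ⟨Z, q, δ, hq₁, hδ, hZ, hq₂, -⟩ := exists_cofiber f
  refine hZ (hg.isZero _ (fun i a => ?_))
  -- Desuspended, `a ≫ δ` becomes a map from another generator to `X` which `f` kills; injectivity
  -- makes it zero. So `a` lifts to `Y`, then to `X` by surjectivity, and `f ≫ q = 0` finishes.
  have h1 : a ≫ δ = 0 := by
    obtain ⟨j, ⟨e⟩⟩ := hg.desuspension i
    obtain ⟨e', b, hb⟩ := exists_eq_comp_shift_map e (a ≫ δ)
    have hb0 : b = 0 := by
      refine (hf j).1 ((shiftFunctor T (1 : ℤ)).map_injective ?_)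
      dsimp only
      rw [Functor.map_comp, zero_comp, Functor.map_zero, ← cancel_epi e'.hom, ← Category.assoc,
        ← hb, Category.assoc, hδ, comp_zero, comp_zero]
    rw [hb, hb0, Functor.map_zero, comp_zero]
  obtain ⟨b, hb⟩ := hq₂ _ a h1
  obtain ⟨c, rfl⟩ := (hf i).2 b
  rw [hb, Category.assoc, hq₁, comp_zero]

variable [HasCoproducts.{v} T]

/-- Every sequence has a homotopy colimit: a weak colimit `Y` for cohomological functors such that
morphisms from compact objects to `Y` factor through the sequence. -/
lemma exists_homotopyColimit (X : ℕ → T) (i : ∀ n, X n ⟶ X (n + 1)) :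
    ∃ (Y : T) (π : ∀ n, X n ⟶ Y), (∀ n, i n ≫ π (n + 1) = π n) ∧
      (∀ (H : Tᵒᵖ ⥤ AddCommGrpCat.{v}) [H.Additive] (_ : IsCohomological H)
        (u : ∀ n, H.obj (op (X n))) (_ : ∀ n, H.map (i n).op (u (n + 1)) = u n),
        ∃ t : H.obj (op Y), ∀ n, H.map (π n).op t = u n) ∧
      ∀ (x : T) (_ : compactObjects T x) (a : x ⟶ Y), ∃ (n : ℕ) (c : x ⟶ X n), a = c ≫ π n := by
  -- The homotopy colimit is the cofiber of `1 - s`, where `s` moves the `n`-th summand of the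
  -- coproduct to the next one.
  let X' : ULift.{v} ℕ → T := fun n => X n.down
  let ι (n : ℕ) : X n ⟶ ∐ X' := Sigma.ι X' ⟨n⟩
  let s : ∐ X' ⟶ ∐ X' := Sigma.desc (fun n => i n.down ≫ ι (n.down + 1))
  have hs (n : ℕ) : ι n ≫ s = i n ≫ ι (n + 1) := Sigma.ι_desc _ _
  let p (n : ℕ) : ∐ X' ⟶ X n := Sigma.π X' ⟨n⟩
  have hp (n : ℕ) : ι n ≫ p n = 𝟙 _ := Sigma.ι_π_eq_id X' ⟨n⟩
  have hp' (m n : ℕ) (h : m ≠ n) : ι m ≫ p n = 0 :=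
    Sigma.ι_π_of_ne X' (fun h' => h (congrArg ULift.down h'))
  have hsp0 : s ≫ p 0 = 0 := by
    refine Sigma.hom_ext _ _ ?_
    rintro ⟨n⟩
    change ι n ≫ s ≫ p 0 = _
    rw [← Category.assoc, hs, Category.assoc, hp' _ _ (Nat.succ_ne_zero n)]
    simp
  have hsp (n : ℕ) : s ≫ p (n + 1) = p n ≫ i n := by
    refine Sigma.hom_ext _ _ ?_
    rintro ⟨m⟩
    change ι m ≫ s ≫ p (n + 1) = ι m ≫ p n ≫ i n
    rw [← Category.assoc, hs, Category.assoc]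
    by_cases h : m = n
    · subst h
      rw [hp, reassoc_of% hp m, Category.comp_id]
    · rw [hp' _ _ (fun h' => h (Nat.succ_injective h')), ← Category.assoc, hp' _ _ h]
      simp
  -- If `b = b ≫ s`, the components of `b` vanish inductively: `s` misses stage `0`, and component
  -- `n + 1` comes from component `n`. By compactness `b` is the finite sum of its components.
  have hinj (x : T) (hx : compactObjects T x) (b : x ⟶ ∐ X') (hb : b ≫ (𝟙 _ - s) = 0) :
      b = 0 := by
    have hb' : b ≫ s = b := by
      rw [Preadditive.comp_sub, Category.comp_id, sub_eq_zero] at hb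
      exact hb.symm
    have hbp (n : ℕ) : b ≫ p n = 0 := by
      induction n with
      | zero => rw [← hb', Category.assoc, hsp0, comp_zero]
      | succ n ih => rw [← hb', Category.assoc, hsp, ← Category.assoc, ih, zero_comp]
    obtain ⟨S, hS⟩ : ∃ S : Finset ℕ, b = ∑ n ∈ S, (b ≫ p n) ≫ ι n := by
      have hfin : ∃ N : ℕ, ∀ M ≥ N, b = ∑ n ∈ Finset.range M, (b ≫ p n) ≫ ι n := by
        refine AddSubgroup.closure_induction (p := fun (b : x ⟶ ∐ X') _ => ∃ N : ℕ, ∀ M ≥ N,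
          b = ∑ n ∈ Finset.range M, (b ≫ p n) ≫ ι n) ?_ ?_ ?_ ?_ (hx.mem_closure X' b)
        · rintro _ ⟨⟨j⟩, a, rfl⟩
          refine ⟨j + 1, fun M hM => ?_⟩
          change a ≫ ι j = ∑ n ∈ Finset.range M, ((a ≫ ι j) ≫ p n) ≫ ι n
          rw [Finset.sum_eq_single j]
          · rw [Category.assoc a, hp]
            exact congrArg (· ≫ ι j) (Category.comp_id a).symm
          · intro n _ hn
            rw [Category.assoc a, hp' _ _ hn.symm]
            simp
          · intro h
            exact absurd (Finset.mem_range.2 hM) h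
        · exact ⟨0, fun M _ => by simp⟩
        · rintro b₁ b₂ _ _ ⟨N₁, h₁⟩ ⟨N₂, h₂⟩
          refine ⟨max N₁ N₂, fun M hM => ?_⟩
          simp only [Preadditive.add_comp, Finset.sum_add_distrib]
          rw [← h₁ M (le_of_max_le_left hM), ← h₂ M (le_of_max_le_right hM)]
        · rintro b₁ _ ⟨N₁, h₁⟩
          refine ⟨N₁, fun M hM => ?_⟩
          simp only [Preadditive.neg_comp, Finset.sum_neg_distrib]
          rw [← h₁ M hM]
      obtain ⟨N, hN⟩ := hfin
      exact ⟨_, hN N le_rfl⟩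
    rw [hS]
    exact Finset.sum_eq_zero (fun n _ => by rw [hbp, zero_comp])
  obtain ⟨Y, q, δ, hq₁, hδ, -, hq₂, hq₃⟩ := exists_cofiber (𝟙 (∐ X') - s)
  have hq : s ≫ q = q := by
    rw [Preadditive.sub_comp, Category.id_comp, sub_eq_zero] at hq₁
    exact hq₁.symm
  refine ⟨Y, fun n => ι n ≫ q, fun n => ?_, ?_, ?_⟩
  · rw [← Category.assoc, ← hs, Category.assoc, hq]
  · intro H _ hH u hu
    obtain ⟨t', ht', -⟩ := hH.coproduct X' (fun n => u n.down)
    have ht' (n : ℕ) : H.map (ι n).op t' = u n := ht' ⟨n⟩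
    -- Elements over a coproduct are determined by their restrictions to the summands, and there
    -- compatibility of the `u n` gives zero.
    have h0 : H.map (𝟙 (∐ X') - s).op t' = 0 := by
      obtain ⟨z, -, hz⟩ := hH.coproduct X' (fun n => 0)
      rw [hz (H.map (𝟙 (∐ X') - s).op t'), hz 0]
      · intro j; simp
      · rintro ⟨n⟩
        change H.map (ι n).op _ = _
        rw [← presheaf_map_comp, Preadditive.comp_sub, hs, presheaf_map_sub, presheaf_map_comp,
          presheaf_map_comp, ht', hu, op_id, H.map_id, ConcreteCategory.id_apply, ht', sub_self]
    obtain ⟨t, ht⟩ := hq₃ H hH t' h0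
    refine ⟨t, fun n => ?_⟩
    dsimp only
    rw [presheaf_map_comp]
    exact (congrArg _ ht).trans (ht' n)
  · intro x hx a
    have h1 : a ≫ δ = 0 := by
      obtain ⟨e, b, hb⟩ := exists_eq_comp_shift_map (Iso.refl _) (a ≫ δ)
      have hb0 : b = 0 := by
        refine hinj _ (hx.shift (-1)) b ((shiftFunctor T (1 : ℤ)).map_injective ?_)
        rw [Functor.map_comp, Functor.map_zero, ← cancel_epi e.hom, ← Category.assoc, ← hb,
          Category.assoc, hδ, comp_zero, comp_zero]
      rw [hb, hb0, Functor.map_zero, comp_zero]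
    obtain ⟨b, hb⟩ := hq₂ _ a h1
    -- Asking for all large stages, not just one, lets two summands be compared at a common stage;
    -- moving up is possible because `s ≫ q = q`.
    have hfin : ∃ N : ℕ, ∀ M ≥ N, ∃ c : x ⟶ X M, b ≫ q = c ≫ ι M ≫ q := by
      refine AddSubgroup.closure_induction (p := fun (b : x ⟶ ∐ X') _ => ∃ N : ℕ, ∀ M ≥ N,
          ∃ c : x ⟶ X M, b ≫ q = c ≫ ι M ≫ q) ?_ ?_ ?_ ?_ (hx.mem_closure X' b)
      · rintro _ ⟨⟨j⟩, a, rfl⟩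
        refine ⟨j, fun M hM => ?_⟩
        induction M, hM using Nat.le_induction with
        | base => exact ⟨a, Category.assoc _ _ _⟩
        | succ M _ ih =>
          obtain ⟨c, hc⟩ := ih
          refine ⟨c ≫ i M, ?_⟩
          rw [hc, Category.assoc, ← Category.assoc (i M), ← hs, Category.assoc (ι M), hq]
      · exact ⟨0, fun M _ => ⟨0, by simp⟩⟩
      · rintro b₁ b₂ _ _ ⟨N₁, h₁⟩ ⟨N₂, h₂⟩
        refine ⟨max N₁ N₂, fun M hM => ?_⟩
        obtain ⟨c₁, hc₁⟩ := h₁ M (le_of_max_le_left hM)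
        obtain ⟨c₂, hc₂⟩ := h₂ M (le_of_max_le_right hM)
        exact ⟨c₁ + c₂, by simp [hc₁, hc₂]⟩
      · rintro b₁ _ ⟨N₁, h₁⟩
        refine ⟨N₁, fun M hM => ?_⟩
        obtain ⟨c₁, hc₁⟩ := h₁ M hM
        exact ⟨-c₁, by simp [hc₁]⟩
    obtain ⟨N, hN⟩ := hfin
    obtain ⟨c, hc⟩ := hN N le_rfl
    exact ⟨N, c, hb.trans hc⟩

variable {H : Tᵒᵖ ⥤ AddCommGrpCat.{v}} [H.Additive]

/-- At each stage all maps from generators which kill the element are coned off, and the element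
extends by exactness. In the homotopy colimit a map from a generator comes from some stage `n`, so
if it kills the element it dies at stage `n + 1`. -/
lemma IsCohomological.exists_extension_injective (hH : IsCohomological H)
    (hg : IsCompactGeneratingFamily g) (X₀ : T) (u₀ : H.obj (op X₀)) :
    ∃ (X : T) (u : H.obj (op X)) (f : X₀ ⟶ X), H.map f.op u = u₀ ∧
      ∀ (i : I) (a : g i ⟶ X), H.map a.op u = 0 → a = 0 := by
  have step (P : Σ X : T, H.obj (op X)) : ∃ (Q : Σ X : T, H.obj (op X)) (f : P.1 ⟶ Q.1),
      H.map f.op Q.2 = P.2 ∧ ∀ (i : I) (a : g i ⟶ P.1), H.map a.op P.2 = 0 → a ≫ f = 0 := by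
    let J := Σ i : I, {a : g i ⟶ P.1 // H.map a.op P.2 = 0}
    let r : ∐ (fun j : J => g j.1) ⟶ P.1 := Sigma.desc (fun j => j.2.1)
    have hr : H.map r.op P.2 = 0 := by
      obtain ⟨z, -, hz⟩ := hH.coproduct (fun j : J => g j.1) (fun _ => 0)
      rw [hz (H.map r.op P.2), hz 0]
      · intro j; simp
      · intro j
        rw [← presheaf_map_comp, Sigma.ι_desc]
        exact j.2.2
    obtain ⟨Y, q, δ, hq, -, -, -, hq'⟩ := exists_cofiber r
    obtain ⟨u, hu⟩ := hq' H hH P.2 hr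
    refine ⟨⟨Y, u⟩, q, hu, fun i a ha => ?_⟩
    have h1 : Sigma.ι (fun j : J => g j.1) ⟨i, a, ha⟩ ≫ r = a := Sigma.ι_desc _ _
    rw [← h1, Category.assoc, hq, comp_zero]
  choose next f hf hf' using step
  let P (n : ℕ) : Σ X : T, H.obj (op X) := Nat.rec ⟨X₀, u₀⟩ (fun _ P => next P) n
  obtain ⟨Y, π, hπ, hY, hY'⟩ := exists_homotopyColimit (fun n => (P n).1) (fun n => f (P n))
  obtain ⟨u, hu⟩ := hY H hH (fun n => (P n).2) (fun n => hf (P n))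
  refine ⟨Y, u, π 0, hu 0, fun i a ha => ?_⟩
  obtain ⟨n, c, rfl⟩ := hY' _ (hg.compact i) a
  rw [presheaf_map_comp, hu] at ha
  rw [← hπ, ← Category.assoc, hf' (P n) i c ha, zero_comp]

/-- An element of a cohomological functor which is universal for the generators is
universal. -/
lemma IsCohomological.bijective_of_generators (hH : IsCohomological H)
    (hg : IsCompactGeneratingFamily g) {X : T} (u : H.obj (op X))
    (hu : ∀ i : I, Function.Bijective (fun a : g i ⟶ X => H.map a.op u)) (Y : T) :
    Function.Bijective (fun a : Y ⟶ X => H.map a.op u) := by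
  -- Every extension of `u` along a map `q` is split: embed `Z` in a `W` whose element is injective
  -- on generators. Then `X ⟶ W` is bijective on maps from generators, hence invertible.
  have key {Z : T} (q : X ⟶ Z) (t : H.obj (op Z)) (ht : H.map q.op t = u) :
      ∃ r : Z ⟶ X, q ≫ r = 𝟙 X ∧ H.map r.op u = t := by
    obtain ⟨W, w, f, hf, hw⟩ := hH.exists_extension_injective hg Z t
    have : IsIso (q ≫ f) := by
      refine hg.isIso _ (fun i => ⟨fun a b hab => (hu i).1 ?_, fun b => ?_⟩)
      · dsimp only at hab ⊢
        rw [← ht, ← hf, ← presheaf_map_comp H q, ← presheaf_map_comp, hab, presheaf_map_comp]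
      · obtain ⟨a, ha⟩ := (hu i).2 (H.map b.op w)
        refine ⟨a, sub_eq_zero.1 (hw i _ ?_)⟩
        dsimp only at ha ⊢
        rw [presheaf_map_sub, presheaf_map_comp, presheaf_map_comp, hf, ht, ha, sub_self]
    refine ⟨f ≫ inv (q ≫ f), by rw [← Category.assoc, IsIso.hom_inv_id], ?_⟩
    have h1 : H.map (inv (q ≫ f)).op u = w := by
      rw [← ht, ← hf, ← presheaf_map_comp H q, ← presheaf_map_comp, IsIso.inv_hom_id, op_id,
        H.map_id, ConcreteCategory.id_apply]
    rw [presheaf_map_comp, h1, hf]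
  constructor
  · intro a b hab
    -- Since `u` vanishes on `a - b`, it extends to the cofiber; the map to the cofiber is then a
    -- split monomorphism killing `a - b`.
    obtain ⟨Z, q, δ, h1, -, -, -, hq⟩ := exists_cofiber (a - b)
    obtain ⟨t, ht⟩ := hq H hH u (by
      dsimp only at hab
      rw [presheaf_map_sub, hab, sub_self])
    obtain ⟨r, hr, -⟩ := key q t ht
    rw [← sub_eq_zero, ← Category.comp_id (a - b), ← hr, ← Category.assoc, h1, zero_comp]
  · intro y
    -- For surjectivity, extend `u` to the coproduct of `X` and `Y` by the prescribed `y`, and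
    -- retract onto `X`.
    let XY : ULift.{v} Bool → T := fun b => cond b.down X Y
    let h : ∀ b, H.obj (op (XY b)) := fun
      | ⟨true⟩ => u
      | ⟨false⟩ => y
    obtain ⟨t, ht, -⟩ := hH.coproduct XY h
    obtain ⟨r, -, hr⟩ := key (Sigma.ι XY ⟨true⟩) t (ht ⟨true⟩)
    refine ⟨Sigma.ι XY ⟨false⟩ ≫ r, ?_⟩
    dsimp only
    rw [presheaf_map_comp, hr]
    exact ht ⟨false⟩

/-- **Brown representability.** -/
theorem IsCohomological.exists_universal (hH : IsCohomological H)
    (hg : IsCompactGeneratingFamily g) :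
    ∃ (X : T) (u : H.obj (op X)), ∀ Y : T,
      Function.Bijective (fun a : Y ⟶ X => H.map a.op u) := by
  -- Starting from one copy of a generator for each element of `H` on it secures surjectivity; the
  -- subsequent extension secures injectivity.
  let J := Σ i : I, H.obj (op (g i))
  obtain ⟨u₀, hu₀, -⟩ := hH.coproduct (fun j : J => g j.1) (fun j => j.2)
  obtain ⟨X, u, f, hf, hu⟩ := hH.exists_extension_injective hg _ u₀
  refine ⟨X, u, hH.bijective_of_generators hg u (fun i => ⟨fun a b hab => ?_, fun y => ?_⟩)⟩
  · refine sub_eq_zero.1 (hu i _ ?_)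
    dsimp only at hab
    rw [presheaf_map_sub, hab, sub_self]
  · refine ⟨Sigma.ι (fun j : J => g j.1) ⟨i, y⟩ ≫ f, ?_⟩
    dsimp only
    rw [presheaf_map_comp, hf]
    exact hu₀ ⟨i, y⟩

end Brown

/-! ### Existence of right adjoints -/

section Adjoints

variable {T : Type u₁} [Category.{v} T] [Preadditive T] [HasShift T ℤ]
  [∀ n : ℤ, (shiftFunctor T n).Additive]

/-- All shifts of the generators are added, which gives closure under desuspension; `Shrink` keeps
the index type in universe `v`. -/
lemma IsCompactlyGeneratedCategory.exists_family (hT : IsCompactlyGeneratedCategory T) :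
    ∃ (I : Type v) (g : I → T), IsCompactGeneratingFamily g := by
  obtain ⟨-, G, hG, hG₁, hG₂⟩ := hT
  have hG : Small.{v} (Subtype G) := hG
  let g (i : Shrink.{v} (Subtype G) × ULift.{v} ℤ) : T :=
    ((equivShrink (Subtype G)).symm i.1).1⟦i.2.down⟧
  refine ⟨_, g, ⟨fun i => (hG₁ _ ((equivShrink (Subtype G)).symm i.1).2).shift _, fun i => ?_,
    fun t ht => hG₂ t (fun x hx a => ?_)⟩⟩
  · exact ⟨⟨i.1, ⟨i.2.down + (-1)⟩⟩, ⟨(shiftFunctorAdd T i.2.down (-1)).app _⟩⟩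
  · have e : x ≅ g ⟨equivShrink _ ⟨x, hx⟩, ⟨0⟩⟩ :=
      ((shiftFunctorZero T ℤ).app x).symm ≪≫ (shiftFunctor T (0 : ℤ)).mapIso
        (eqToIso (by rw [Equiv.symm_apply_apply]))
    rw [← cancel_epi e.inv, ht _ (e.inv ≫ a), comp_zero]

variable [HasZeroObject T] [Pretriangulated T]
  {S : Type u₂} [Category.{v} S] [Preadditive S] [HasZeroObject S] [HasShift S ℤ]
  [∀ n : ℤ, (shiftFunctor S n).Additive] [Pretriangulated S]

lemma isCohomological_preadditiveYoneda (F : T ⥤ S) [F.CommShift ℤ] [F.IsTriangulated]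
    (hF : ∀ J : Type v, PreservesColimitsOfShape (Discrete J) F) (c : S) :
    IsCohomological (F.op ⋙ preadditiveYoneda.obj c) where
  exact Δ hΔ u hu := by
    obtain ⟨w, hw⟩ := Triangle.yoneda_exact₂ _ (F.map_distinguished Δ hΔ) u hu
    exact ⟨w, hw.symm⟩
  coproduct {J} X _ h := by
    have := hF J
    let hc := isColimitOfPreserves F (colimit.isColimit (Discrete.functor X))
    refine ⟨hc.desc (Cocone.mk c (Discrete.natTrans (fun j => h j.as))),
      fun j => hc.fac _ ⟨j⟩, fun y hy => hc.hom_ext ?_⟩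
    rintro ⟨j⟩
    exact (hy j).trans (hc.fac (Cocone.mk c (Discrete.natTrans (fun j => h j.as))) ⟨j⟩).symm

/-- An exact functor which preserves coproducts and whose source is compactly generated has a
right adjoint. -/
theorem isLeftAdjoint_of_preservesCoproducts (hT : IsCompactlyGeneratedCategory T) (F : T ⥤ S)
    [F.CommShift ℤ] [F.IsTriangulated]
    (hF : ∀ J : Type v, PreservesColimitsOfShape (Discrete J) F) : F.IsLeftAdjoint := by
  have := hT.1
  obtain ⟨I, g, hg⟩ := hT.exists_family
  -- An object representing `S(F -, c)`, with its universal element, is a terminal object of this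
  -- comma category.
  have (c : S) : HasTerminal (CostructuredArrow F c) := by
    obtain ⟨X, u, hu⟩ := (isCohomological_preadditiveYoneda F hF c).exists_universal hg
    refine IsTerminal.hasTerminal (X := CostructuredArrow.mk (show F.obj X ⟶ c from u)) ?_
    refine IsTerminal.ofUniqueHom (fun Y => CostructuredArrow.homMk
      ((hu Y.left).2 Y.hom).choose ((hu Y.left).2 Y.hom).choose_spec) (fun Y m => ?_)
    ext
    exact (hu Y.left).1 ((CostructuredArrow.w m).trans
      ((hu Y.left).2 Y.hom).choose_spec.symm)
  exact isLeftAdjoint_of_costructuredArrowTerminals F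

end Adjoints

/-! ### Right adjoints that preserve coproducts -/

section RightAdjoint

variable {T : Type u₁} [Category.{v} T] [Preadditive T] [HasZeroObject T] [HasShift T ℤ]
  [∀ n : ℤ, (shiftFunctor T n).Additive] [Pretriangulated T]
  {S : Type u₂} [Category.{v} S] [Preadditive S]

/-- The right adjoint of a functor which preserves compact objects preserves coproducts, if the
source of the left adjoint is compactly generated. -/
lemma preservesCoproducts_rightAdjoint (hT : IsCompactlyGeneratedCategory T)
    (hS : HasCoproducts.{v} S) {F : T ⥤ S} [F.Additive] {R : S ⥤ T} (adj : F ⊣ R)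
    (hF : ∀ x, compactObjects T x → compactObjects S (F.obj x)) (J : Type v) :
    PreservesColimitsOfShape (Discrete J) R := by
  have := hT.1
  obtain ⟨I, g, hg⟩ := hT.exists_family
  have : R.Additive := adj.right_adjoint_additive
  have (X : J → S) : PreservesColimit (Discrete.functor X) R := ?_
  · exact preservesColimitsOfShape_of_discrete R
  -- Test on generators: `T(g, R -) ≅ S(F g, -)`, and both `g` and `F g` are compact.
  have : IsIso (sigmaComparison R X) := by
    refine hg.isIso _ (fun i => ?_)
    let K := preadditiveCoyoneda.obj (op (g i))
    have := hg.compact i J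
    have := hF _ (hg.compact i) J
    have e : preadditiveCoyoneda.obj (op (F.obj (g i))) ≅ R ⋙ K :=
      NatIso.ofComponents (fun b => (adj.homAddEquiv (g i) b).toAddCommGrpIso) (fun f => by
            ext a
            exact adj.homEquiv_naturality_right a f)
    have : PreservesColimitsOfShape (Discrete J) (R ⋙ K) :=
      preservesColimitsOfShape_of_natIso e
    have h : sigmaComparison K (fun j => R.obj (X j)) ≫ K.map (sigmaComparison R X) =
        sigmaComparison (R ⋙ K) X :=
      Sigma.hom_ext _ _ (fun j => by
        rw [ι_comp_sigmaComparison_assoc, ← K.map_comp, ι_comp_sigmaComparison]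
        exact (ι_comp_sigmaComparison (R ⋙ K) X j).symm)
    have : IsIso (K.map (sigmaComparison R X)) :=
      IsIso.of_isIso_fac_left h
    exact ConcreteCategory.bijective_of_isIso (K.map (sigmaComparison R X))
  exact PreservesCoproduct.of_iso_comparison R X

end RightAdjoint

/-! ### Lemmas on monoidal categories -/

section Monoidal

variable {C : Type u₁} [Category.{v} C] [MonoidalCategory C]

/-- One triangle identity yields the other after pairing with `ε`. When `ε` is the universal
evaluation, nothing is lost by that pairing. -/
lemma whiskerLeft_snake_comp {x y : C} (η : 𝟙_ C ⟶ y ⊗ x) (ε : x ⊗ y ⟶ 𝟙_ C)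
    (h : x ◁ η ≫ (α_ x y x).inv ≫ ε ▷ x = (ρ_ x).hom ≫ (λ_ x).inv) :
    x ◁ (η ▷ y ≫ (α_ y x y).hom ≫ y ◁ ε ≫ (ρ_ y).hom) ≫ ε = x ◁ (λ_ y).hom ≫ ε := by
  have h : x ◁ η ⊗≫ ε ▷ x = ⊗𝟙.hom := by
    convert! h using 1 <;> simp [monoidalComp]
  calc
    _ = 𝟙 _ ⊗≫ x ◁ η ▷ y ⊗≫ ((x ⊗ y) ◁ ε ≫ ε ▷ 𝟙_ C) ⊗≫ 𝟙 _ := by monoidal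
    _ = 𝟙 _ ⊗≫ (x ◁ η ⊗≫ ε ▷ x) ▷ y ⊗≫ ε := by
      rw [whisker_exchange]; monoidal
    _ = _ := by rw [h]; monoidal

/-- A strong monoidal functor preserves dualities. -/
abbrev exactPairingMap {D : Type u₂} [Category.{v} D] [MonoidalCategory D] (F : C ⥤ D) [F.Monoidal]
    (x y : C) [ExactPairing x y] : ExactPairing (F.obj x) (F.obj y) where
  coevaluation' := Functor.LaxMonoidal.ε F ≫ F.map (η_ x y) ≫ Functor.OplaxMonoidal.δ F x y
  evaluation' := Functor.LaxMonoidal.μ F y x ≫ F.map (ε_ x y) ≫ Functor.OplaxMonoidal.η F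
  coevaluation_evaluation' := by
    have h := F.congr_map (ExactPairing.coevaluation_evaluation x y)
    simp only [F.map_comp, Functor.Monoidal.map_whiskerLeft, Functor.Monoidal.map_whiskerRight,
      Functor.Monoidal.map_associator_inv, Functor.Monoidal.map_rightUnitor,
      Functor.Monoidal.map_leftUnitor_inv, Category.assoc, Functor.Monoidal.μ_δ_assoc,
      cancel_epi] at h
    simp only [← Category.assoc, cancel_mono] at h
    simp only [Category.assoc] at h
    simp only [whiskerLeft_comp, comp_whiskerRight, Category.assoc, reassoc_of% h]
    simp
  evaluation_coevaluation' := by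
    have h := F.congr_map (ExactPairing.evaluation_coevaluation x y)
    simp only [F.map_comp, Functor.Monoidal.map_whiskerLeft, Functor.Monoidal.map_whiskerRight,
      Functor.Monoidal.map_associator, Functor.Monoidal.map_leftUnitor,
      Functor.Monoidal.map_rightUnitor_inv, Category.assoc, Functor.Monoidal.μ_δ_assoc,
      cancel_epi] at h
    simp only [← Category.assoc, cancel_mono] at h
    simp only [Category.assoc] at h
    simp only [whiskerLeft_comp, comp_whiskerRight, Category.assoc, reassoc_of% h]
    simp

variable [SymmetricCategory C]

lemma isEquivalence_tensorLeft_of_iso {x x' : C} (e : x ⊗ x' ≅ 𝟙_ C) :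
    (tensorLeft x).IsEquivalence :=
  (CategoryTheory.Equivalence.mk (tensorLeft x) (tensorLeft x')
    ((leftUnitorNatIso C).symm ≪≫ (curriedTensor C).mapIso (e.symm ≪≫ β_ x x') ≪≫
      tensorLeftTensor x' x)
    ((tensorLeftTensor x x').symm ≪≫ (curriedTensor C).mapIso e ≪≫
      leftUnitorNatIso C)).isEquivalence_functor

lemma braiding_evaluation (x x' y : C) (q : x' ⊗ x ⟶ 𝟙_ C) :
    (α_ x' y x).hom ≫ x' ◁ (β_ y x).hom ≫ (α_ x' x y).inv ≫ q ▷ y ≫ (λ_ y).hom =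
      (β_ x' y).hom ▷ x ≫ (α_ y x' x).hom ≫ y ◁ q ≫ (ρ_ y).hom := by
  have h : q ▷ y ≫ (λ_ y).hom = (β_ (x' ⊗ x) y).hom ≫ y ◁ q ≫ (ρ_ y).hom := by
    rw [← BraidedCategory.braiding_naturality_left_assoc, braiding_rightUnitor]
  rw [h, BraidedCategory.braiding_tensor_left_hom]
  simp only [Category.assoc, Iso.inv_hom_id_assoc]
  rw [← whiskerLeft_comp_assoc, SymmetricCategory.symmetry, whiskerLeft_id, Category.id_comp,
    Iso.hom_inv_id_assoc]

/-- Together with its primed variant, this computes `tensorHomMap` and `doubleHomMap` on a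
generalized element `g`, once `x` is moved across by duality. -/
lemma braiding_evaluation_whiskerRight {x x' y V w a : C} (q : x' ⊗ x ⟶ 𝟙_ C) (e : y ⊗ V ⟶ w)
    (g : a ⟶ x ⊗ V) :
    x' ◁ (y ◁ g ≫ (α_ y x V).inv ≫ (β_ y x).hom ▷ V ≫ (α_ x y V).hom ≫ x ◁ e) ≫
        (α_ x' x w).inv ≫ q ▷ w ≫ (λ_ w).hom =
      (α_ x' y a).inv ≫ (β_ x' y).hom ▷ a ≫ (α_ y x' a).hom ≫
        y ◁ (x' ◁ g ≫ (α_ x' x V).inv ≫ q ▷ V ≫ (λ_ V).hom) ≫ e := by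
  calc
    _ = 𝟙 _ ⊗≫ x' ◁ y ◁ g ⊗≫ x' ◁ (β_ y x).hom ▷ V ⊗≫
        ((x' ⊗ x) ◁ e ≫ q ▷ w) ⊗≫ 𝟙 _ := by monoidal
    _ = 𝟙 _ ⊗≫ x' ◁ y ◁ g ⊗≫ ((α_ x' y x).hom ≫ x' ◁ (β_ y x).hom ≫ (α_ x' x y).inv ≫ q ▷ y ≫
        (λ_ y).hom) ▷ V ⊗≫ e := by
      rw [whisker_exchange]; monoidal
    _ = 𝟙 _ ⊗≫ ((x' ⊗ y) ◁ g ≫ (β_ x' y).hom ▷ (x ⊗ V)) ⊗≫ y ◁ q ▷ V ⊗≫ e := by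
      rw [braiding_evaluation]; monoidal
    _ = _ := by
      rw [whisker_exchange]; monoidal

lemma braiding_evaluation_whiskerRight' {x x' y V w a : C} (p : x ⊗ x' ⟶ 𝟙_ C) (e : y ⊗ V ⟶ w)
    (g : a ⟶ x ⊗ V) :
    (x' ⊗ y) ◁ g ≫ (α_ (x' ⊗ y) x V).inv ≫
        ((β_ (x' ⊗ y) x).hom ≫ (α_ x x' y).inv ≫ p ▷ y ≫ (λ_ y).hom) ▷ V ≫ e =
      (β_ x' y).hom ▷ a ≫ (α_ y x' a).hom ≫
        y ◁ (x' ◁ g ≫ (α_ x' x V).inv ≫ ((β_ x' x).hom ≫ p) ▷ V ≫ (λ_ V).hom) ≫ e := by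
  calc
    _ = 𝟙 _ ⊗≫ (x' ⊗ y) ◁ g ⊗≫ ((α_ x' y x).hom ≫ x' ◁ (β_ y x).hom ≫ (α_ x' x y).inv ≫
        ((β_ x' x).hom ≫ p) ▷ y ≫ (λ_ y).hom) ▷ V ⊗≫ e := by
      rw [BraidedCategory.braiding_tensor_left_hom]; monoidal
    _ = 𝟙 _ ⊗≫ ((x' ⊗ y) ◁ g ≫ (β_ x' y).hom ▷ (x ⊗ V)) ⊗≫ y ◁ ((β_ x' x).hom ≫ p) ▷ V ⊗≫ e := by
      rw [braiding_evaluation]; monoidal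
    _ = _ := by
      rw [whisker_exchange]; monoidal

end Monoidal

/-! ### Rigid objects -/

section Closed

variable {C : Type u₁} [Category.{v} C] [MonoidalCategory C] [MonoidalClosed C]

lemma uncurry_rigidityMap (x y : C) : MonoidalClosed.uncurry (rigidityMap x y) =
    (α_ x ((ihom x).obj (𝟙_ C)) y).inv ≫ ((ihom.ev x).app (𝟙_ C)) ▷ y ≫ (λ_ y).hom :=
  MonoidalClosed.uncurry_curry _

lemma isIso_curry_of_bijective {x A y : C} (k : x ⊗ A ⟶ y)
    (h : ∀ a : C, Function.Bijective (fun g : a ⟶ A => x ◁ g ≫ k)) :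
    IsIso (MonoidalClosed.curry k) := by
  refine isIso_of_yoneda_map_bijective _ (fun a => ?_)
  have : (fun g : a ⟶ A => g ≫ MonoidalClosed.curry k) =
      ((ihom.adjunction x).homEquiv a y) ∘ (fun g : a ⟶ A => x ◁ g ≫ k) := by
    ext g
    exact (MonoidalClosed.curry_natural_left g k).symm
  rw [this]
  exact ((ihom.adjunction x).homEquiv a y).bijective.comp (h a)

/-- The duality between a rigid object `x` and `[x, 𝟙]`. -/
abbrev IsRigidObject.exactPairing {x : C} (hx : IsRigidObject x) :
    ExactPairing ((ihom x).obj (𝟙_ C)) x :=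
  have := hx x
  have h₁ : x ◁ (MonoidalClosed.curry (ρ_ x).hom ≫ inv (rigidityMap x x)) ≫
      (α_ x ((ihom x).obj (𝟙_ C)) x).inv ≫ (ihom.ev x).app (𝟙_ C) ▷ x =
        (ρ_ x).hom ≫ (λ_ x).inv := by
    rw [← cancel_mono (λ_ x).hom]
    simp only [Category.assoc, Iso.inv_hom_id, Category.comp_id]
    rw [← uncurry_rigidityMap, ← MonoidalClosed.uncurry_natural_left, Category.assoc,
      IsIso.inv_hom_id, Category.comp_id, MonoidalClosed.uncurry_curry]
  { coevaluation' := MonoidalClosed.curry (ρ_ x).hom ≫ inv (rigidityMap x x)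
    evaluation' := (ihom.ev x).app (𝟙_ C)
    coevaluation_evaluation' := h₁
    evaluation_coevaluation' := by
      generalize MonoidalClosed.curry (ρ_ x).hom ≫ inv (rigidityMap x x) = η at h₁ ⊢
      rw [← cancel_mono (ρ_ _).hom]
      -- Maps into `[x, 𝟙]` are determined by their pairing with evaluation, so the first triangle
      -- identity suffices.
      apply MonoidalClosed.uncurry_injective
      rw [MonoidalClosed.uncurry_eq, MonoidalClosed.uncurry_eq]
      simp only [Category.assoc, Iso.inv_hom_id, Category.comp_id]
      exact whiskerLeft_snake_comp η _ h₁ }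

/-- Both `y ⊗ -` and `[x, -]` are right adjoint to `x ⊗ -`. The comparison at `𝟙` identifies `y`
with `[x, 𝟙]`, and under this identification the rigidity map is the comparison at `w`. -/
lemma isRigidObject_of_exactPairing (y x : C) [ExactPairing y x] : IsRigidObject x := by
  let k (w : C) : x ⊗ (y ⊗ w) ⟶ w := (α_ _ _ _).inv ≫ (ε_ y x) ▷ w ≫ (λ_ w).hom
  have hk (w : C) : IsIso (MonoidalClosed.curry (k w)) :=
    isIso_curry_of_bijective _ (fun a => (tensorLeftHomEquiv a y x w).symm.bijective)
  let t : y ⟶ (ihom x).obj (𝟙_ C) := MonoidalClosed.curry (ε_ y x)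
  have ht : IsIso t := by
    have : t = (ρ_ y).inv ≫ MonoidalClosed.curry (k (𝟙_ C)) := by
      rw [← MonoidalClosed.curry_natural_left]
      refine congrArg MonoidalClosed.curry ?_
      simp only [k]
      monoidal
    rw [this]
    infer_instance
  intro w
  have : t ▷ w ≫ rigidityMap x w = MonoidalClosed.curry (k w) := by
    apply MonoidalClosed.uncurry_injective
    rw [MonoidalClosed.uncurry_natural_left, uncurry_rigidityMap, MonoidalClosed.uncurry_curry,
      associator_inv_naturality_middle_assoc, ← comp_whiskerRight_assoc]
    simp only [t, MonoidalClosed.whiskerLeft_curry_ihom_ev_app, k]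
  exact IsIso.of_isIso_fac_left this

lemma IsRigidObject.map {D : Type u₂} [Category.{v} D] [MonoidalCategory D]
    [MonoidalClosed D] {x : C} (hx : IsRigidObject x) (F : C ⥤ D) [F.Monoidal] :
    IsRigidObject (F.obj x) := by
  let := hx.exactPairing
  let := exactPairingMap F ((CategoryTheory.ihom x).obj (𝟙_ C)) x
  exact isRigidObject_of_exactPairing (F.obj ((CategoryTheory.ihom x).obj (𝟙_ C))) _

lemma IsRigidObject.of_iso {x y : C} (hx : IsRigidObject x) (e : x ≅ y) : IsRigidObject y := by
  let := hx.exactPairing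
  let := exactPairingCongrRight (X := (ihom x).obj (𝟙_ C)) e.symm
  exact isRigidObject_of_exactPairing ((ihom x).obj (𝟙_ C)) y

lemma IsRigidObject.tensor {x y : C} (hx : IsRigidObject x) (hy : IsRigidObject y) :
    IsRigidObject (x ⊗ y) := by
  let := hx.exactPairing
  let := hy.exactPairing
  exact isRigidObject_of_exactPairing ((ihom y).obj (𝟙_ C) ⊗ (ihom x).obj (𝟙_ C)) _

variable (C) in
lemma isRigidObject_unit : IsRigidObject (𝟙_ C) :=
  isRigidObject_of_exactPairing (𝟙_ C) (𝟙_ C)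

end Closed

/-! ### Rigidity in the symmetric case -/

section Rigid

variable {C : Type u₁} [Category.{v} C] [MonoidalCategory C] [SymmetricCategory C]
  [MonoidalClosed C]

lemma IsRigidObject.dual {x : C} (hx : IsRigidObject x) :
    IsRigidObject ((ihom x).obj (𝟙_ C)) := by
  let := hx.exactPairing
  let := BraidedCategory.exactPairing_swap ((ihom x).obj (𝟙_ C)) x
  exact isRigidObject_of_exactPairing x _

lemma IsRigidObject.ihom {x y : C} (hx : IsRigidObject x) (hy : IsRigidObject y) :
    IsRigidObject ((ihom x).obj y) :=
  have := hx y
  (hx.dual.tensor hy).of_iso (asIso (rigidityMap x y))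

/-- As `x ⊗ -` is an equivalence, evaluation is invertible; so is the rigidity map after tensoring
with `x`, hence before. -/
lemma IsTensorInvertible.isRigidObject {x : C} (hx : IsTensorInvertible x) :
    IsRigidObject x := by
  obtain ⟨x', ⟨e⟩⟩ := hx
  have := isEquivalence_tensorLeft_of_iso e
  have hev (y : C) : IsIso ((ihom.ev x).app y) := by
    rw [← ihom.ihom_adjunction_counit]
    infer_instance
  intro y
  have h := uncurry_rigidityMap x y
  rw [MonoidalClosed.uncurry_eq] at h
  have : IsIso (x ◁ rigidityMap x y) := by
    have : IsIso (x ◁ rigidityMap x y ≫ (ihom.ev x).app y) := by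
      rw [h]; infer_instance
    exact IsIso.of_isIso_comp_right _ ((ihom.ev x).app y)
  have : IsIso ((tensorLeft x).map (rigidityMap x y)) := this
  exact isIso_of_reflects_iso _ (tensorLeft x)

/-- With `x'` dual to `x`, maps from `a` to either side both amount to maps `x' ⊗ (y ⊗ a) ⟶ w`. -/
lemma isIso_tensorHomMap {x : C} (hx : IsRigidObject x) (y w : C) :
    IsIso (tensorHomMap x y w) := by
  let := hx.exactPairing
  let := BraidedCategory.exactPairing_swap ((ihom x).obj (𝟙_ C)) x
  refine isIso_curry_of_bijective _ (fun a => ?_)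
  let x' := (ihom x).obj (𝟙_ C)
  let r : x' ⊗ (y ⊗ a) ≅ y ⊗ (x' ⊗ a) :=
    (α_ _ _ _).symm ≪≫ whiskerRightIso (β_ x' y) a ≪≫ α_ _ _ _
  let e : (a ⟶ x ⊗ (CategoryTheory.ihom y).obj w) ≃ (x' ⊗ (y ⊗ a) ⟶ w) :=
    (tensorLeftHomEquiv a x x' _).symm.trans
      (((ihom.adjunction y).homEquiv _ _).symm.trans r.symm.homFromEquiv)
  refine ((tensorLeftHomEquiv (y ⊗ a) x x' w).symm.bijective.of_comp_iff' _).1 ?_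
  convert! e.bijective using 1
  ext g
  refine (braiding_evaluation_whiskerRight (ε_ x x') ((ihom.ev y).app w) g).trans ?_
  have he (f : x' ⊗ a ⟶ (CategoryTheory.ihom y).obj w) :
      ((ihom.adjunction y).homEquiv (x' ⊗ a) w).symm f = y ◁ f ≫ (ihom.ev y).app w :=
    MonoidalClosed.uncurry_eq f
  simp [e, r, tensorLeftHomEquiv, he]

/-- Same test, now using `[x, y] ≅ x' ⊗ y`, the rigidity of `x`. -/
lemma isIso_doubleHomMap {x : C} (hx : IsRigidObject x) (y w : C) :
    IsIso (doubleHomMap x y w) := by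
  let := hx.exactPairing
  let := BraidedCategory.exactPairing_swap ((ihom x).obj (𝟙_ C)) x
  refine isIso_curry_of_bijective _ (fun a => ?_)
  let x' := (ihom x).obj (𝟙_ C)
  have := hx y
  let r : (ihom x).obj y ⊗ a ≅ y ⊗ (x' ⊗ a) :=
    whiskerRightIso (asIso (rigidityMap x y)).symm a ≪≫ whiskerRightIso (β_ x' y) a ≪≫ α_ _ _ _
  let e : (a ⟶ x ⊗ (CategoryTheory.ihom y).obj w) ≃ ((ihom x).obj y ⊗ a ⟶ w) :=
    (tensorLeftHomEquiv a x x' _).symm.trans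
      (((ihom.adjunction y).homEquiv _ _).symm.trans r.symm.homFromEquiv)
  convert! e.bijective using 1
  ext g
  rw [← cancel_epi (rigidityMap x y ▷ a), ← whisker_exchange_assoc,
    associator_inv_naturality_left_assoc, ← comp_whiskerRight_assoc,
    BraidedCategory.braiding_naturality_left_assoc, ← MonoidalClosed.uncurry_eq,
    uncurry_rigidityMap]
  refine (braiding_evaluation_whiskerRight' ((ihom.ev x).app (𝟙_ C)) ((ihom.ev y).app w) g).trans ?_
  have hε : ε_ x x' = (β_ x' x).hom ≫ (ihom.ev x).app (𝟙_ C) := rfl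
  have he (f : x' ⊗ a ⟶ (CategoryTheory.ihom y).obj w) :
      ((ihom.adjunction y).homEquiv (x' ⊗ a) w).symm f = y ◁ f ≫ (ihom.ev y).app w :=
    MonoidalClosed.uncurry_eq f
  simp [e, r, tensorLeftHomEquiv, he, hε, x']

end Rigid

/-! ### The projection formula and duality -/

section Projection

variable {C : Type u₁} [Category.{v} C] [MonoidalCategory C]
  {D : Type u₂} [Category.{v} D] [MonoidalCategory D]
  {F : D ⥤ C} [F.Monoidal] {R : C ⥤ D} {G : D ⥤ C}

/-- The projection map `R z ⊗ d ⟶ R (z ⊗ F d)`. -/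
def projectionMap (adj : F ⊣ R) (z : C) (d : D) : R.obj z ⊗ d ⟶ R.obj (z ⊗ F.obj d) :=
  letI := adj.rightAdjointLaxMonoidal
  R.obj z ◁ adj.unit.app d ≫ Functor.LaxMonoidal.μ R z (F.obj d)

/-- This is the adjunct of the projection map, the form in which it can be compared with other maps.
-/
lemma map_projectionMap_comp_counit (adj : F ⊣ R) (z : C) (d : D) :
    F.map (projectionMap adj z d) ≫ adj.counit.app (z ⊗ F.obj d) =
      Functor.OplaxMonoidal.δ F (R.obj z) d ≫ adj.counit.app z ▷ F.obj d := by
  let := adj.rightAdjointLaxMonoidal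
  simp only [projectionMap, Functor.map_comp, Category.assoc,
    adj.map_μ_comp_counit_app_tensor]
  refine (Functor.OplaxMonoidal.δ_natural_right_assoc F (R.obj z) (adj.unit.app d) _).symm.trans ?_
  simp [MonoidalCategory.tensorHom_def', ← whiskerLeft_comp_assoc]

/-- The projection formula for objects which have a dual. -/
lemma isIso_projectionMap (adj : F ⊣ R) (z : C) (d' d : D) [ExactPairing d' d] :
    IsIso (projectionMap adj z d) := by
  refine isIso_of_yoneda_map_bijective _ (fun a => ?_)
  let := exactPairingMap F d' d
  -- Maps from `a` to either side of the projection formula are identified with maps `F a ⊗ F d' ⟶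
  -- z`.
  let e : (a ⟶ R.obj z ⊗ d) ≃ (F.obj a ⊗ F.obj d' ⟶ z) :=
    (tensorRightHomEquiv a d' d _).symm.trans
      ((adj.homEquiv _ _).symm.trans (Functor.Monoidal.μIso F a d').symm.homFromEquiv)
  let e' : (a ⟶ R.obj (z ⊗ F.obj d)) ≃ (F.obj a ⊗ F.obj d' ⟶ z) :=
    (adj.homEquiv _ _).symm.trans (tensorRightHomEquiv _ (F.obj d') (F.obj d) _).symm
  refine (e'.bijective.of_comp_iff' _).1 ?_
  convert! e.bijective using 1
  ext f
  have hε : ε_ (F.obj d') (F.obj d) = Functor.LaxMonoidal.μ F d d' ≫ F.map (ε_ d' d) ≫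
    Functor.OplaxMonoidal.η F := rfl
  simp [e, e', tensorRightHomEquiv, Adjunction.homEquiv_counit, map_projectionMap_comp_counit, hε]
  simp only [Functor.Monoidal.map_whiskerLeft, Functor.Monoidal.map_whiskerRight,
    Functor.Monoidal.map_associator, Functor.Monoidal.map_rightUnitor, Category.assoc,
    Functor.Monoidal.μ_δ_assoc]
  rw [← rightUnitor_naturality, whisker_exchange_assoc, whisker_exchange_assoc,
    whisker_exchange_assoc, whiskerRight_tensor]
  simp

end Projection

/-! ### The duality map on dualizable test objects -/

section Dualizing

variable {C : Type u₁} [Category.{v} C] [MonoidalCategory C] [MonoidalClosed C]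
  {D : Type u₂} [Category.{v} D] [MonoidalCategory D] [MonoidalClosed D]
  {F : D ⥤ C} [F.Monoidal] {R : C ⥤ D} {G : D ⥤ C}

/-- The equivalence `e` chains `F ⊣ R`, tensor-hom in `C`, `R ⊣ G`, the projection formula and
tensor-hom in `D`; unwinding it gives exactly composition with `dualizingMap`. -/
lemma bijective_comp_dualizingMap (adj : F ⊣ R) (adj' : R ⊣ G) (z : C) (d' d : D)
    [ExactPairing d' d] :
    Function.Bijective (fun g : d ⟶ R.obj ((ihom z).obj (dualizingObject G)) =>
      g ≫ dualizingMap adj adj' z) := by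
  let := adj.rightAdjointLaxMonoidal
  have := isIso_projectionMap adj z d' d
  let e : (d ⟶ R.obj ((ihom z).obj (dualizingObject G))) ≃ (d ⟶ tensorDual (R.obj z)) :=
    (adj.homEquiv _ _).symm.trans
      (((ihom.adjunction z).homEquiv _ _).symm.trans
        ((adj'.homEquiv _ _).symm.trans
          ((asIso (projectionMap adj z d)).symm.homFromEquiv.trans
            ((ihom.adjunction (R.obj z)).homEquiv _ _))))
  convert! e.bijective using 1
  ext g
  obtain ⟨g, rfl⟩ := (adj.homEquiv _ _).surjective g
  have h : e (adj.homEquiv _ _ g) = MonoidalClosed.curry (projectionMap adj z d ≫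
    R.map (z ◁ g ≫ (ihom.ev z).app (dualizingObject G)) ≫ adj'.counit.app (𝟙_ D)) := by
    simp [e, Adjunction.homEquiv_counit]
    rw [← R.map_comp_assoc]
    rfl
  rw [h, dualizingMap, ← MonoidalClosed.curry_natural_left, Adjunction.homEquiv_unit]
  simp [projectionMap]

end Dualizing

/-! ### Naturality of the canonical maps -/

section Naturality

variable {C : Type u₁} [Category.{v} C] [MonoidalCategory C] [SymmetricCategory C]
  [MonoidalClosed C]

lemma uncurry_doubleHomMap (x y w : C) : MonoidalClosed.uncurry (doubleHomMap x y w) =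
    (α_ ((ihom x).obj y) x ((ihom y).obj w)).inv ≫
      ((β_ ((ihom x).obj y) x).hom ≫ (ihom.ev x).app y) ▷ ((ihom y).obj w) ≫
      (ihom.ev y).app w :=
  MonoidalClosed.uncurry_curry _

lemma uncurry_tensorHomMap (x y w : C) : MonoidalClosed.uncurry (tensorHomMap x y w) =
    (α_ y x ((ihom y).obj w)).inv ≫ (β_ y x).hom ▷ ((ihom y).obj w) ≫
      (α_ x y ((ihom y).obj w)).hom ≫ x ◁ (ihom.ev y).app w :=
  MonoidalClosed.uncurry_curry _

lemma doubleHomMap_naturality_left {x x' : C} (a : x ⟶ x') (y w : C) :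
    a ▷ (ihom y).obj w ≫ doubleHomMap x' y w =
      doubleHomMap x y w ≫ (MonoidalClosed.pre ((MonoidalClosed.pre a).app y)).app w := by
  apply MonoidalClosed.uncurry_injective
  have h : (MonoidalClosed.pre a).app y ▷ x ≫ (β_ _ x).hom ≫ (ihom.ev x).app y =
      (ihom x').obj y ◁ a ≫ (β_ _ x').hom ≫ (ihom.ev x').app y := by
    rw [BraidedCategory.braiding_naturality_left_assoc,
      BraidedCategory.braiding_naturality_right_assoc, MonoidalClosed.id_tensor_pre_app_comp_ev]
  rw [MonoidalClosed.uncurry_natural_left, MonoidalClosed.uncurry_pre_app, uncurry_doubleHomMap,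
    uncurry_doubleHomMap, associator_inv_naturality_left_assoc, ← comp_whiskerRight_assoc, h,
    associator_inv_naturality_middle_assoc, ← comp_whiskerRight_assoc]

lemma doubleHomMap_naturality_right (x : C) {y y' : C} (b : y ⟶ y') (w : C) :
    x ◁ (MonoidalClosed.pre b).app w ≫ doubleHomMap x y w =
      doubleHomMap x y' w ≫ (MonoidalClosed.pre ((ihom x).map b)).app w := by
  apply MonoidalClosed.uncurry_injective
  have h : (ihom x).map b ▷ x ≫ (β_ _ x).hom ≫ (ihom.ev x).app y' =
      ((β_ _ x).hom ≫ (ihom.ev x).app y) ≫ b := by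
    rw [BraidedCategory.braiding_naturality_left_assoc, ihom.ev_naturality, Category.assoc]
  rw [MonoidalClosed.uncurry_natural_left, MonoidalClosed.uncurry_pre_app, uncurry_doubleHomMap,
    uncurry_doubleHomMap, associator_inv_naturality_left_assoc, ← comp_whiskerRight_assoc, h,
    associator_inv_naturality_right_assoc, whisker_exchange_assoc, comp_whiskerRight _ b,
    Category.assoc]
  congr 2
  exact MonoidalClosed.id_tensor_pre_app_comp_ev b w

lemma tensorHomMap_naturality_left {x x' : C} (a : x ⟶ x') (y w : C) :
    a ▷ (ihom y).obj w ≫ tensorHomMap x' y w =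
      tensorHomMap x y w ≫ (ihom y).map (a ▷ w) := by
  apply MonoidalClosed.uncurry_injective
  rw [MonoidalClosed.uncurry_natural_left, MonoidalClosed.uncurry_natural_right,
    uncurry_tensorHomMap, uncurry_tensorHomMap]
  simp only [Category.assoc]
  rw [associator_inv_naturality_middle_assoc, ← comp_whiskerRight_assoc,
    BraidedCategory.braiding_naturality_right, comp_whiskerRight_assoc,
    associator_naturality_left_assoc]
  congr 3
  exact (whisker_exchange a ((ihom.ev y).app w)).symm

lemma tensorHomMap_naturality_right (x : C) {y y' : C} (b : y ⟶ y') (w : C) :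
    x ◁ (MonoidalClosed.pre b).app w ≫ tensorHomMap x y w =
      tensorHomMap x y' w ≫ (MonoidalClosed.pre b).app (x ⊗ w) := by
  apply MonoidalClosed.uncurry_injective
  rw [MonoidalClosed.uncurry_natural_left, MonoidalClosed.uncurry_pre_app,
    uncurry_tensorHomMap, uncurry_tensorHomMap, associator_inv_naturality_right_assoc,
    whisker_exchange_assoc, associator_naturality_right_assoc, ← whiskerLeft_comp,
    MonoidalClosed.id_tensor_pre_app_comp_ev, whiskerLeft_comp,
    associator_inv_naturality_left_assoc, ← comp_whiskerRight_assoc (b ▷ x),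
    BraidedCategory.braiding_naturality_left, comp_whiskerRight_assoc,
    associator_naturality_middle_assoc]

end Naturality

section Dualizing

variable {C : Type u₁} [Category.{v} C] [MonoidalCategory C] [MonoidalClosed C]
  {D : Type u₂} [Category.{v} D] [MonoidalCategory D] [MonoidalClosed D]
  {F : D ⥤ C} [F.Monoidal] {R : C ⥤ D} {G : D ⥤ C}

lemma dualizingMap_naturality (adj : F ⊣ R) (adj' : R ⊣ G) {z z' : C} (c : z ⟶ z') :
    R.map ((MonoidalClosed.pre c).app (dualizingObject G)) ≫ dualizingMap adj adj' z =
      dualizingMap adj adj' z' ≫ (MonoidalClosed.pre (R.map c)).app (𝟙_ D) := by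
  let := adj.rightAdjointLaxMonoidal
  apply MonoidalClosed.uncurry_injective
  rw [MonoidalClosed.uncurry_natural_left, MonoidalClosed.uncurry_pre_app, dualizingMap,
    dualizingMap, MonoidalClosed.uncurry_curry, MonoidalClosed.uncurry_curry,
    Functor.LaxMonoidal.μ_natural_right_assoc, Functor.LaxMonoidal.μ_natural_left_assoc,
    ← R.map_comp_assoc, ← R.map_comp_assoc, MonoidalClosed.id_tensor_pre_app_comp_ev]

end Dualizing

/-! ### Relative Serre duality -/

section SerreDuality

variable {C : Type u₁} [Category.{v} C] [MonoidalCategory C] [SymmetricCategory C]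
  [MonoidalClosed C]
  {D : Type u₂} [Category.{v} D] [MonoidalCategory D] [MonoidalClosed D]
  {F : D ⥤ C} [F.Monoidal] {R : C ⥤ D} {G : D ⥤ C}

/-- The canonical map `R (x ⊗ [y, ω]) ⟶ [R [x, y], 𝟙]`. -/
def toDualRichHom (adj : F ⊣ R) (adj' : R ⊣ G) (x y : C) :
    R.obj (x ⊗ (ihom y).obj (dualizingObject G)) ⟶ tensorDual (richHom R x y) :=
  R.map (doubleHomMap x y (dualizingObject G)) ≫ dualizingMap adj adj' ((ihom x).obj y)

lemma toDualRichHom_naturality_left (adj : F ⊣ R) (adj' : R ⊣ G) {x x' : C} (a : x ⟶ x')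
    (y : C) :
    R.map (a ▷ (ihom y).obj (dualizingObject G)) ≫ toDualRichHom adj adj' x' y =
      toDualRichHom adj adj' x y ≫
        (MonoidalClosed.pre (R.map ((MonoidalClosed.pre a).app y))).app (𝟙_ D) := by
  rw [toDualRichHom, ← R.map_comp_assoc, doubleHomMap_naturality_left, R.map_comp_assoc,
    dualizingMap_naturality, toDualRichHom, Category.assoc]

lemma toDualRichHom_naturality_right (adj : F ⊣ R) (adj' : R ⊣ G) (x : C) {y y' : C}
    (b : y ⟶ y') :
    R.map (x ◁ (MonoidalClosed.pre b).app (dualizingObject G)) ≫ toDualRichHom adj adj' x y =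
      toDualRichHom adj adj' x y' ≫
        (MonoidalClosed.pre (R.map ((ihom x).map b))).app (𝟙_ D) := by
  rw [toDualRichHom, ← R.map_comp_assoc, doubleHomMap_naturality_right, R.map_comp_assoc,
    dualizingMap_naturality, toDualRichHom, Category.assoc]

/-- Naturality of `m⁻¹ ≫ n` from that of `m` and `n`, used in each variable of the Serre
isomorphism. -/
lemma comp_inv_comp_of_comm {E : Type u₁} [Category.{v} E] {X X' Y Y' Z Z' : E} {p : X ⟶ X'}
    {q : Y ⟶ Y'} {r : Z ⟶ Z'} {m : X ⟶ Y} {m' : X' ⟶ Y'} {n : X ⟶ Z} {n' : X' ⟶ Z'} [IsIso m]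
    [IsIso m'] (h₁ : p ≫ m' = m ≫ q) (h₂ : p ≫ n' = n ≫ r) :
    q ≫ inv m' ≫ n' = (inv m ≫ n) ≫ r := by
  rw [← cancel_epi m, ← reassoc_of% h₁, IsIso.hom_inv_id_assoc, h₂, Category.assoc,
    IsIso.hom_inv_id_assoc]

/-- The isomorphism `[R [x, y], 𝟙] ≅ R [y, x ⊗ ω]`. -/
def relativeSerreIso (adj : F ⊣ R) (adj' : R ⊣ G) (x y : C) [IsIso (toDualRichHom adj adj' x y)]
    [IsIso (tensorHomMap x y (dualizingObject G))] :
    tensorDual (richHom R x y) ≅ richHom R y (x ⊗ dualizingObject G) :=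
  (asIso (toDualRichHom adj adj' x y)).symm ≪≫
    R.mapIso (asIso (tensorHomMap x y (dualizingObject G)))

lemma isCanonicalSerreMap_iff (adj : F ⊣ R) (adj' : R ⊣ G) (x y : C)
    [IsIso (toDualRichHom adj adj' x y)] [IsIso (tensorHomMap x y (dualizingObject G))]
    (s : tensorDual (richHom R x y) ⟶ richHom R y (x ⊗ dualizingObject G)) :
    IsCanonicalSerreMap adj adj' x y s ↔ s = (relativeSerreIso adj adj' x y).hom := by
  refine Iff.trans ?_ (IsIso.eq_inv_comp (toDualRichHom adj adj' x y)).symm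
  unfold IsCanonicalSerreMap
  rw [← Category.assoc]
  rfl

variable [Preadditive C]

/-- **Relative Serre duality**, if all duality maps `R [z, ω] ⟶ [R z, 𝟙]` are isomorphisms. -/
lemma existsUnique_relativeSerreDuality (adj : F ⊣ R) (adj' : R ⊣ G)
    (hC : ∀ x : C, compactObjects C x → IsRigidObject x)
    (hd : ∀ z : C, IsIso (dualizingMap adj adj' z)) :
    ∃! σ : (compactObjects C).ι ⋙ dualRichHom R ≅
        richHomInto R ((compactObjects C).ι ⋙ tensorRight (dualizingObject G)),
      ∀ (x : CompactSubcategory C) (y : C),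
        IsCanonicalSerreMap adj adj' x.obj y ((σ.hom.app x).app (op y)) := by
  have h₁ (x : CompactSubcategory C) (y : C) : IsIso (toDualRichHom adj adj' x.obj y) := by
    have := isIso_doubleHomMap (hC _ x.property) y (dualizingObject G)
    have := hd ((ihom x.obj).obj y)
    rw [toDualRichHom]
    infer_instance
  have h₂ (x : CompactSubcategory C) (y : C) :
      IsIso (tensorHomMap x.obj y (dualizingObject G)) :=
    isIso_tensorHomMap (hC _ x.property) y _
  let e (x : CompactSubcategory C) (y : C) := relativeSerreIso adj adj' x.obj y
  refine ⟨NatIso.ofComponents (fun x => NatIso.ofComponents (fun y => e x y.unop) ?_) ?_, ?_, ?_⟩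
  · intro y y' b
    have h := R.congr_map (tensorHomMap_naturality_right x.obj b.unop (dualizingObject G))
    rw [R.map_comp, R.map_comp] at h
    have := comp_inv_comp_of_comm (toDualRichHom_naturality_right adj adj' x.obj b.unop) h
    exact this
  · intro x x' a
    ext y
    have h := R.congr_map (tensorHomMap_naturality_left a.hom y.unop (dualizingObject G))
    rw [R.map_comp, R.map_comp] at h
    have := comp_inv_comp_of_comm (toDualRichHom_naturality_left adj adj' a.hom y.unop) h
    exact this
  · intro x y
    exact (isCanonicalSerreMap_iff adj adj' x.obj y _).2 rfl
  · intro τ hτ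
    ext x y
    exact (isCanonicalSerreMap_iff adj adj' x.obj y.unop _).1 (hτ x y.unop)

end SerreDuality

/-! ### The Wirthmüller isomorphism -/

section Wirthmueller

variable {C : Type u₁} [Category.{v} C] [MonoidalCategory C] 

lemma isEquivalence_tensorRight [SymmetricCategory C] {w : C} (hw : IsTensorInvertible w) :
    (tensorRight w).IsEquivalence := by
  obtain ⟨w', ⟨e⟩⟩ := hw
  have := isEquivalence_tensorLeft_of_iso e
  exact Functor.isEquivalence_of_iso (BraidedCategory.tensorLeftIsoTensorRight w)

lemma IsTensorInvertible.of_iso {x y : C} (hx : IsTensorInvertible x) (e : x ≅ y) :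
    IsTensorInvertible y := by
  obtain ⟨x', ⟨i⟩⟩ := hx
  exact ⟨x', ⟨whiskerRightIso e.symm x' ≪≫ i⟩⟩

variable [SymmetricCategory C] [MonoidalClosed C]
  {D : Type u₂} [Category.{v} D] [MonoidalCategory D]
  {F : D ⥤ C} [F.Monoidal] {R : C ⥤ D} {G : D ⥤ C}

/-- If `R (l ⊗ -)` is left adjoint to `F`, then the relative dualizing object is isomorphic
to `l`. -/
lemma nonempty_iso_dualizingObject (adj' : R ⊣ G) {L : C ⥤ D} (adjL : L ⊣ F) {l : C}
    (hl : IsTensorInvertible l) (e : L ≅ tensorLeft l ⋙ R) :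
    Nonempty (l ≅ dualizingObject G) := by
  obtain ⟨l', ⟨i⟩⟩ := hl
  have := isEquivalence_tensorLeft_of_iso i
  have : IsIso ((ihom.ev l).app (dualizingObject G)) := by
    rw [← ihom.ihom_adjunction_counit]
    infer_instance
  -- Both are right adjoint to `R (l ⊗ -)`. At the unit this reads `𝟙 ≅ [l, ω]`, and tensoring with
  -- the invertible `l` gives `l ≅ ω`.
  let e₁ : F ≅ G ⋙ ihom l :=
    adjL.rightAdjointUniq (((ihom.adjunction l).comp adj').ofNatIsoLeft e.symm)
  exact ⟨(ρ_ l).symm ≪≫ whiskerLeftIso l (Functor.Monoidal.εIso F ≪≫ e₁.app (𝟙_ D)) ≪≫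
    asIso ((ihom.ev l).app (dualizingObject G))⟩

end Wirthmueller

/-! ### Compact objects and invertible twists -/

section RigidlyCompactlyGenerated

variable {C : Type u₁} [Category.{v} C] [Preadditive C] [MonoidalCategory C] [SymmetricCategory C]
  [MonoidalClosed C] [RigidlyCompactlyGenerated C]

lemma compactObjects.isRigidObject {x : C} (hx : compactObjects C x) : IsRigidObject x :=
  (RigidlyCompactlyGenerated.compact_iff_rigid x).1 hx

lemma IsRigidObject.compactObjects {x : C} (hx : IsRigidObject x) : compactObjects C x :=
  (RigidlyCompactlyGenerated.compact_iff_rigid x).2 hx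

lemma compactObjects.tensor {x y : C} (hx : compactObjects C x) (hy : IsRigidObject y) :
    compactObjects C (x ⊗ y) :=
  (hx.isRigidObject.tensor hy).compactObjects

lemma isEquivalence_tensorOnCompacts {w : C} (hw : IsTensorInvertible w)
    (hw' : ∀ x : C, compactObjects C x → compactObjects C (x ⊗ w)) :
    (tensorOnCompacts w hw').IsEquivalence := by
  have := isEquivalence_tensorRight hw
  have : (tensorOnCompacts w hw').Full := by unfold tensorOnCompacts; infer_instance
  have : (tensorOnCompacts w hw').Faithful := by unfold tensorOnCompacts; infer_instance
  have : (tensorOnCompacts w hw').EssSurj := ⟨fun y => by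
    obtain ⟨w', ⟨i⟩⟩ := hw
    have hw₁ : IsRigidObject w' := IsTensorInvertible.isRigidObject ⟨w, ⟨β_ _ _ ≪≫ i⟩⟩
    exact ⟨⟨y.obj ⊗ w', y.property.tensor hw₁⟩, ⟨(compactObjects C).isoMk
      (α_ _ _ _ ≪≫ whiskerLeftIso y.obj (β_ _ _ ≪≫ i) ≪≫ ρ_ _)⟩⟩⟩
  exact {}

variable {D : Type u₂} [Category.{v} D] [Preadditive D] [MonoidalCategory D]

lemma compactObjects.map [SymmetricCategory D] [MonoidalClosed D] [RigidlyCompactlyGenerated D]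
    (F : D ⥤ C) [F.Monoidal] {x : D} (hx : compactObjects D x) :
    compactObjects C (F.obj x) :=
  (hx.isRigidObject.map F).compactObjects

variable {F : D ⥤ C} [F.Monoidal] {R : C ⥤ D} {G : D ⥤ C}

/-- In the situation of the Wirthmüller isomorphism, `R` preserves compact objects and the
relative dualizing object is `⊗`-invertible. -/
lemma WirthmuellerSituation.compact_and_invertible [F.Additive]
    (hF : ∀ J : Type v, PreservesColimitsOfShape (Discrete J) F) (adj' : R ⊣ G)
    (h : WirthmuellerSituation F R G) :
    (∀ x : C, compactObjects C x → compactObjects D (R.obj x)) ∧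
      IsTensorInvertible (dualizingObject G) := by
  obtain h | ⟨L, ⟨adjL⟩, l, hl, ⟨e⟩⟩ := h
  · exact h
  · obtain ⟨i⟩ := nonempty_iso_dualizingObject adj' adjL hl e
    refine ⟨fun x hx => ?_, hl.of_iso i⟩
    obtain ⟨l', ⟨j⟩⟩ := hl
    have hl' : IsRigidObject l' := IsTensorInvertible.isRigidObject ⟨l, ⟨β_ _ _ ≪≫ j⟩⟩
    -- Since `x ≅ l ⊗ (l' ⊗ x)`, the object `R x` is `L (l' ⊗ x)`; and `L` preserves compact objects
    -- because its right adjoint `F` preserves coproducts.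
    have hx' : compactObjects C (l' ⊗ x) := (hl'.tensor hx.isRigidObject).compactObjects
    exact (hx'.leftAdjoint_obj adjL hF).of_iso (e.app _ ≪≫
      R.mapIso ((α_ _ _ _).symm ≪≫ whiskerRightIso j x ≪≫ λ_ x))

variable [SymmetricCategory D] [MonoidalClosed D] [RigidlyCompactlyGenerated D] in
/-- The restriction to compact objects of a relative Serre duality isomorphism. -/
def RelativeSerreFunctor.ofIso
    (hR : ∀ x : C, compactObjects C x → compactObjects D (R.obj x)) {w : C}
    (hw : IsTensorInvertible w)
    (hw' : ∀ x : C, compactObjects C x → compactObjects C (x ⊗ w))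
    (σ : (compactObjects C).ι ⋙ dualRichHom R ≅
        richHomInto R ((compactObjects C).ι ⋙ tensorRight w)) :
    RelativeSerreFunctor R (tensorOnCompacts w hw') where
  isEquivalence := isEquivalence_tensorOnCompacts hw hw'
  richHom_compact x y :=
    hR _ (x.property.isRigidObject.ihom y.property.isRigidObject).compactObjects
  σ := Functor.isoWhiskerRight σ
    ((Functor.whiskeringLeft _ _ D).obj (compactObjects C).ι.op)

end RigidlyCompactlyGenerated

/-! ### Invertibility of the duality map -/

section Duality

variable {C : Type u₁} [Category.{v} C] [MonoidalCategory C] [MonoidalClosed C]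
  {D : Type u₂} [Category.{v} D] [Preadditive D] [HasZeroObject D] [HasShift D ℤ]
  [∀ n : ℤ, (shiftFunctor D n).Additive] [Pretriangulated D]
  [MonoidalCategory D] [SymmetricCategory D] [MonoidalClosed D] [RigidlyCompactlyGenerated D]
  {F : D ⥤ C} [F.Monoidal] {R : C ⥤ D} {G : D ⥤ C}

lemma isIso_dualizingMap (adj : F ⊣ R) (adj' : R ⊣ G) (z : C) :
    IsIso (dualizingMap adj adj' z) := by
  obtain ⟨I, g, hg⟩ :=
    (RigidlyCompactlyGenerated.compactlyGenerated (C := D)).exists_family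
  refine hg.isIso _ (fun i => ?_)
  let := (hg.compact i).isRigidObject.exactPairing
  exact bijective_comp_dualizingMap adj adj' z ((ihom (g i)).obj (𝟙_ D)) (g i)

end Duality

/-! ### Existence of both adjoints -/

section Existence

variable {C : Type u₁} [Category.{v} C] [Preadditive C] [HasZeroObject C] [HasShift C ℤ]
  [∀ n : ℤ, (shiftFunctor C n).Additive] [Pretriangulated C]
  [MonoidalCategory C] [SymmetricCategory C] [MonoidalClosed C] [RigidlyCompactlyGenerated C]
  {D : Type u₂} [Category.{v} D] [Preadditive D] [HasZeroObject D] [HasShift D ℤ]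
  [∀ n : ℤ, (shiftFunctor D n).Additive] [Pretriangulated D]
  [MonoidalCategory D] [SymmetricCategory D] [MonoidalClosed D] [RigidlyCompactlyGenerated D]

lemma exists_adjoints (F : D ⥤ C) [F.Monoidal] [F.CommShift ℤ] [F.IsTriangulated]
    (hF : ∀ J : Type v, PreservesColimitsOfShape (Discrete J) F) :
    ∃ (R : C ⥤ D) (G : D ⥤ C), Nonempty (F ⊣ R) ∧ Nonempty (R ⊣ G) := by
  have hC := RigidlyCompactlyGenerated.compactlyGenerated (C := C)
  have hD := RigidlyCompactlyGenerated.compactlyGenerated (C := D)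
  have := isLeftAdjoint_of_preservesCoproducts hD F hF
  let adj := Adjunction.ofIsLeftAdjoint F
  -- The right adjoint of an exact functor is exact, so the representability argument applies to it
  -- in turn.
  let := adj.rightAdjointCommShift ℤ
  have := adj.commShift_of_leftAdjoint ℤ
  have := adj.isTriangulated_rightAdjoint
  have := isLeftAdjoint_of_preservesCoproducts hC F.rightAdjoint
    (preservesCoproducts_rightAdjoint hD hC.1 adj (fun _ hx => hx.map F))
  exact ⟨_, _, ⟨adj⟩, ⟨Adjunction.ofIsLeftAdjoint F.rightAdjoint⟩⟩

end Existence

/-! ### The derived category of a field -/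

section DerivedCategoryOfField

variable (k : Type v) [Field k] [HasDerivedCategory.{w} (ModuleCat.{v} k)]

-- Into a higher degree this is the vanishing of negative extensions; into a lower degree it is
-- projectivity of `k`.
open DerivedCategory in
lemma hom_singleFunctor_eq_zero {a b : ℤ} (hab : a ≠ b)
    (f : (singleFunctor (ModuleCat.{v} k) a).obj (ModuleCat.of k k) ⟶
      (singleFunctor (ModuleCat.{v} k) b).obj (ModuleCat.of k k)) : f = 0 := by
  obtain h | h := hab.lt_or_gt
  · exact TStructure.t.zero_of_isLE_of_isGE f a b h inferInstance inferInstance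
  · have : Projective (ModuleCat.of k k) :=
      ModuleCat.projective_of_free (Module.Basis.singleton Unit k)
    exact from_singleFunctor_obj_eq_zero_of_projective
      (L := (CochainComplex.singleFunctor (ModuleCat.{v} k) b).obj (ModuleCat.of k k)) f b h

-- Maps from `k` in degree `n` detect the homology in degree `n`, and homology detects zero objects.
open DerivedCategory HomologicalComplex in
lemma isZero_of_hom_singleFunctor_eq_zero (X : DerivedCategory (ModuleCat.{v} k))
    (hX : ∀ (n : ℤ) (f : (singleFunctor (ModuleCat.{v} k) n).obj (ModuleCat.of k k) ⟶ X),
      f = 0) : IsZero X := by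
  have : Projective (ModuleCat.of k k) :=
    ModuleCat.projective_of_free (Module.Basis.singleton Unit k)
  have hom {n : ℤ} : IsZero ((homologyFunctor (ModuleCat.{v} k) n).obj X) := by
    let K := Q.objPreimage X
    have e : Q.obj K ≅ X := Q.objObjPreimageIso X
    have hX' (f : Q.obj ((CochainComplex.singleFunctor (ModuleCat.{v} k) n).obj
        (ModuleCat.of k k)) ⟶ Q.obj K) : f = 0 := by
      rw [← cancel_mono e.hom, zero_comp]
      exact hX n _
    have hK (x : ModuleCat.of k k ⟶ K.homology n) : x = 0 := by
      -- A homology class lifts to a cycle, hence to a chain map from the complex `k` in degree `n`.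
      -- That map vanishes in the derived category, so the class is zero.
      let c : ModuleCat.of k k ⟶ K.cycles n := Projective.factorThru x (K.homologyπ n)
      let φ : (single (ModuleCat.{v} k) (ComplexShape.up ℤ) n).obj (ModuleCat.of k k) ⟶ K :=
        mkHomFromSingle (c ≫ K.iCycles n) (fun j _ => by simp)
      have h₁ : homologyMap φ n = 0 := by
        have h := (homologyFunctorFactors (ModuleCat.{v} k) n).inv.naturality φ
        rw [Functor.comp_map, show Q.map φ = 0 from hX' (Q.map φ), Functor.map_zero,
          comp_zero] at h
        exact ((cancel_mono ((homologyFunctorFactors (ModuleCat.{v} k) n).app K).inv).1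
          (h.trans zero_comp.symm))
      have h₂ : (singleObjCyclesSelfIso (ComplexShape.up ℤ) n (ModuleCat.of k k)).inv ≫
          cyclesMap φ n = c := by
        rw [← cancel_mono (K.iCycles n), Category.assoc, cyclesMap_i,
          singleObjCyclesSelfIso_inv_iCycles_assoc]
        simp [φ, mkHomFromSingle_f]
      have h₃ : c ≫ K.homologyπ n = 0 := by
        rw [← h₂, Category.assoc, ← homologyπ_naturality, h₁, comp_zero, comp_zero]
      rw [← h₃]
      exact (Projective.factorThru_comp _ _).symm
    refine IsZero.of_iso ?_ ((homologyFunctor _ n).mapIso e.symm ≪≫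
      (homologyFunctorFactors _ n).app K)
    have hs (a : K.homology n) : a = 0 :=
      (LinearMap.toSpanSingleton_apply_one k _ a).symm.trans (ConcreteCategory.congr_hom
        (hK (ModuleCat.ofHom (LinearMap.toSpanSingleton k (K.homology n) a))) (1 : k))
    have : Subsingleton (K.homology n) := ⟨fun a b => (hs a).trans (hs b).symm⟩
    exact ModuleCat.isZero_of_subsingleton (K.homology n)
  obtain ⟨Z, hZ⟩ := HasZeroObject.zero (C := DerivedCategory (ModuleCat.{v} k))
  have : IsIso (0 : X ⟶ Z) := (DerivedCategory.isIso_iff _ _).2 fun n =>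
    ⟨0, hom.eq_of_src _ _, (Functor.map_isZero _ hZ).eq_of_src _ _⟩
  exact hZ.of_iso (asIso (0 : X ⟶ Z))

lemma bijective_singleFunctor_map_smul : Function.Bijective (fun a : k =>
    (DerivedCategory.singleFunctor (ModuleCat.{v} k) 0).map (a • 𝟙 (ModuleCat.of k k))) := by
  refine (Functor.FullyFaithful.ofFullyFaithful _).map_bijective _ _ |>.comp ?_
  constructor
  · intro a b hab
    have := ConcreteCategory.congr_hom hab (1 : k)
    simpa using this
  · intro f
    refine ⟨f.hom (1 : k), ?_⟩
    ext
    simp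

end DerivedCategoryOfField

/-! ### Representability of the dual of a Hom-functor -/

section DualCoyoneda

variable {k : Type v} [Field k] {T : Type u₁} [Category.{v} T] [Preadditive T] [Linear k T] (t : T)

variable (k) in
/-- The functor `d ↦ Hom_k(T(t, d), k)`. -/
def dualCoyoneda : Tᵒᵖ ⥤ AddCommGrpCat.{v} where
  obj d := AddCommGrpCat.of (Module.Dual k (t ⟶ d.unop))
  map f := AddCommGrpCat.ofHom (Linear.rightComp k t f.unop).dualMap.toAddMonoidHom
  map_id _ := AddCommGrpCat.hom_ext (AddMonoidHom.ext fun (φ : Module.Dual k _) =>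
    LinearMap.ext fun a => congrArg φ (Category.comp_id a))
  map_comp f g := AddCommGrpCat.hom_ext (AddMonoidHom.ext fun (φ : Module.Dual k _) =>
    LinearMap.ext fun a => congrArg φ (Category.assoc a g.unop f.unop).symm)

instance : (dualCoyoneda k t).Additive where
  map_add {_ _ f g} := AddCommGrpCat.hom_ext (AddMonoidHom.ext
    fun (φ : Module.Dual k _) => LinearMap.ext fun a =>
      (congrArg φ (Preadditive.comp_add _ _ _ a f.unop g.unop)).trans (map_add φ _ _))

variable {t}

/-- A `k`-valued family of functionals on the summands extends uniquely to a coproduct. -/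
lemma existsUnique_dual_coproduct (ht : compactObjects T t) {J : Type v} (X : J → T)
    [HasCoproduct X] (h : ∀ j, Module.Dual k (t ⟶ X j)) :
    ∃! u : Module.Dual k (t ⟶ ∐ X), ∀ j (a : t ⟶ X j), u (a ≫ Sigma.ι X j) = h j a := by
  have := ht J
  let hc := isColimitOfPreserves (preadditiveCoyoneda.obj (op t))
    (colimit.isColimit (Discrete.functor X))
  let s : Cocone (Discrete.functor X ⋙ preadditiveCoyoneda.obj (op t)) :=
    Cocone.mk (AddCommGrpCat.of k) (Discrete.natTrans
      (fun j => AddCommGrpCat.ofHom (h j.as).toAddMonoidHom))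
  let u : (t ⟶ ∐ X) →+ k := (hc.desc s).hom
  have hu (j : J) (a : t ⟶ X j) : u (a ≫ Sigma.ι X j) = h j a :=
    ConcreteCategory.congr_hom (hc.fac s ⟨j⟩) a
  -- Compactness provides only an additive extension. Linearity, like uniqueness, is checked on maps
  -- through a single summand, which generate.
  refine ⟨{ u with map_smul' := fun c f => ?_ }, hu, fun u' hu' => ?_⟩
  · have hf := ht.mem_closure X f
    induction hf using AddSubgroup.closure_induction with
    | mem f hf =>
      obtain ⟨j, a, rfl⟩ := hf
      refine (congrArg u (Linear.smul_comp _ _ _ c a _).symm).trans ((hu j _).trans ?_)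
      exact (map_smul (h j) c a).trans (congrArg (c • ·) (hu j a).symm)
    | zero => exact (congrArg u (smul_zero c)).trans (by simp)
    | add f g _ _ hf hg =>
      refine (congrArg u (smul_add c f g)).trans ((map_add u _ _).trans ?_)
      refine (congrArg₂ (· + ·) hf hg).trans ?_
      exact (smul_add c _ _).symm.trans (congrArg (c • ·) (map_add u f g).symm)
    | neg f _ hf =>
      refine (congrArg u (smul_neg c f)).trans ((map_neg u _).trans ?_)
      refine (congrArg (- ·) hf).trans ?_
      exact (smul_neg c _).symm.trans (congrArg (c • ·) (map_neg u f).symm)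
  · refine LinearMap.ext fun f => ?_
    have hf := ht.mem_closure X f
    induction hf using AddSubgroup.closure_induction with
    | mem f hf =>
      obtain ⟨j, a, rfl⟩ := hf
      exact (hu' j a).trans (hu j a).symm
    | zero => simp
    | add f g _ _ hf hg => rw [map_add, map_add, hf, hg]
    | neg f _ hf => rw [map_neg, map_neg, hf]

variable [HasZeroObject T] [HasShift T ℤ] [∀ n : ℤ, (shiftFunctor T n).Additive]
  [Pretriangulated T]

/-- Over a field dualizing is exact: a functional extends along a linear map as soon as it kills the
kernel. -/
lemma isCohomological_dualCoyoneda (ht : compactObjects T t) :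
    IsCohomological (dualCoyoneda k t) where
  exact Δ hΔ u hu := by
    let u' : Module.Dual k (t ⟶ Δ.obj₂) := u
    have h : u' ∈ LinearMap.range (Linear.rightComp k t Δ.mor₂).dualMap := by
      rw [LinearMap.range_dualMap_eq_dualAnnihilator_ker, Submodule.mem_dualAnnihilator]
      intro a ha
      obtain ⟨b, rfl⟩ := Triangle.coyoneda_exact₂ _ hΔ a ha
      exact LinearMap.congr_fun (show u' ∘ₗ Linear.rightComp k t Δ.mor₁ = 0 from hu) b
    exact h
  coproduct {J} X _ h := by
    obtain ⟨u, hu, hu'⟩ := existsUnique_dual_coproduct ht X h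
    exact ⟨u, fun j => LinearMap.ext (hu j),
      fun y hy => hu' y (fun j => LinearMap.congr_fun (hy j))⟩

variable [HasCoproducts.{v} T]

/-- If the shifts of `t` form a compact generating family, and if `t` has no self-extensions
and endomorphism ring `k`, then `t` represents the dual of the functor which is corepresented by
`t`. -/
lemma bijective_dual_comp (hg : IsCompactGeneratingFamily (fun n : ULift.{v} ℤ => t⟦n.down⟧))
    (h₁ : ∀ (n : ℤ) (_ : n ≠ 0) (a : t ⟶ t⟦n⟧), a = 0)
    (h₂ : ∀ (n : ℤ) (_ : n ≠ 0) (a : t⟦n⟧ ⟶ t), a = 0)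
    (u : (t ⟶ t) ≃ₗ[k] k) (hu : u (𝟙 t) = 1) (d : T) :
    Function.Bijective (fun a : d ⟶ t => u.toLinearMap ∘ₗ Linear.rightComp k t a) := by
  have e : t⟦(0 : ℤ)⟧ ≅ t := (shiftFunctorZero T ℤ).app t
  have ht : compactObjects T t := (hg.compact ⟨0⟩).of_iso e
  refine (isCohomological_dualCoyoneda ht).bijective_of_generators hg
    (show (dualCoyoneda k t).obj (op t) from u.toLinearMap) (fun ⟨n⟩ => ?_) d
  -- In degree `0` the pairing is multiplication on the line `k`; in other degrees both sides
  -- vanish.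
  obtain rfl | hn := eq_or_ne n 0
  · refine ⟨fun a a' h => ?_, fun φ => ?_⟩
    · have h := LinearMap.congr_fun (show u.toLinearMap ∘ₗ Linear.rightComp k t a =
        u.toLinearMap ∘ₗ Linear.rightComp k t a' from h) e.inv
      exact (cancel_epi e.inv).1 (u.injective h)
    · let φ' : Module.Dual k (t ⟶ t⟦(0 : ℤ)⟧) := φ
      refine ⟨e.hom ≫ (φ' e.inv • 𝟙 t), LinearMap.ext fun (b : t ⟶ t⟦(0 : ℤ)⟧) => ?_⟩
      have hb : b = u (b ≫ e.hom) • e.inv := by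
        rw [← cancel_mono e.hom, Linear.smul_comp, e.inv_hom_id]
        apply u.injective
        rw [map_smul, hu, smul_eq_mul, mul_one]
      change u (b ≫ e.hom ≫ (φ' e.inv • 𝟙 t)) = φ' b
      conv_rhs => rw [hb]
      rw [← Category.assoc, Linear.comp_smul, Category.comp_id, map_smul, map_smul, smul_eq_mul,
        smul_eq_mul, mul_comm]
  · refine ⟨fun a a' _ => (h₂ n hn a).trans (h₂ n hn a').symm,
      fun φ => ⟨0, LinearMap.ext fun a => ?_⟩⟩
    let φ' : Module.Dual k (t ⟶ t⟦n⟧) := φ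
    change u (a ≫ 0) = φ' a
    rw [h₁ n hn a, comp_zero, map_zero, map_zero]

end DualCoyoneda

/-! ### Linear structures which come from the endomorphisms of the unit -/

section UnitLinear

variable {k : Type v} [Field k] {C : Type u₁} [Category.{v} C] [Preadditive C]
  [MonoidalCategory C] [MonoidalPreadditive C]
  {D : Type u₂} [Category.{v} D] [Preadditive D] [MonoidalCategory D] [MonoidalPreadditive D]

/-- The `k`-linear structure on a monoidal category given by an action of `k` on the unit. -/
abbrev unitLinear (φ : k →+* End (𝟙_ C)) : Linear k C :=
  Linear.ofRingMorphism (endUnitToCatCenter.comp φ)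

lemma unitLinear_smul (φ : k →+* End (𝟙_ C)) (a : k) {X Y : C} (f : X ⟶ Y) :
    let _ := unitLinear φ
    a • f = (λ_ X).inv ≫ (show 𝟙_ C ⟶ 𝟙_ C from φ a) ▷ X ≫ (λ_ X).hom ≫ f :=
  (Category.assoc (λ_ X).inv _ f).trans (congrArg _ (Category.assoc _ _ f))

lemma unitLinear_smul_id (φ : k →+* End (𝟙_ C)) (a : k) :
    let _ := unitLinear φ
    a • 𝟙 (𝟙_ C) = φ a := by
  intro _
  rw [unitLinear_smul, Category.comp_id, unitors_equal, unitors_inv_equal, rightUnitor_naturality,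
    Iso.inv_hom_id_assoc]

lemma monoidalLinear_unitLinear [BraidedCategory C] (φ : k →+* End (𝟙_ C)) :
    let _ := unitLinear φ
    MonoidalLinear k C := by
  intro _
  have key (r : k) {Y Z : C} (f : Y ⟶ Z) (X : C) : (r • f) ▷ X = r • (f ▷ X) := by
    rw [unitLinear_smul, unitLinear_smul]
    monoidal
  refine ⟨fun X Y Z r f => ?_, key⟩
  rw [← cancel_mono (β_ X Z).hom, BraidedCategory.braiding_naturality_right, key, Linear.comp_smul,
    ← BraidedCategory.braiding_naturality_right, Linear.smul_comp]

lemma linear_unitLinear (F : D ⥤ C) [F.Monoidal] [F.Additive] (φ : k →+* End (𝟙_ D)) :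
    let _ := unitLinear φ
    let _ := unitLinear ((endUnitMap F).comp φ)
    F.Linear k := by
  intro _ _
  refine ⟨fun f r => ?_⟩
  rw [unitLinear_smul, unitLinear_smul]
  change _ = _ ≫ (Functor.LaxMonoidal.ε F ≫ F.map (φ r) ≫ Functor.OplaxMonoidal.η F) ▷ _ ≫ _
  rw [F.map_comp, F.map_comp, F.map_comp, Functor.Monoidal.map_leftUnitor,
    Functor.Monoidal.map_leftUnitor_inv, Functor.Monoidal.map_whiskerRight]
  simp only [comp_whiskerRight, Category.assoc, Functor.Monoidal.μ_δ_assoc]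

end UnitLinear

/-! ### The unit and its shifts over a field -/

section UnitOfDerivedCategory

variable {k : Type v} [Field k] [HasDerivedCategory.{w} (ModuleCat.{v} k)]
  {D : Type u₂} [Category.{v} D] [Preadditive D] [MonoidalCategory D]

lemma bijective_scalarsToEndUnit (E : D ⥤ DerivedCategory (ModuleCat.{v} k)) [E.IsEquivalence]
    [E.Additive] (ι : E.obj (𝟙_ D) ≅ derivedUnit k) :
    Function.Bijective (scalarsToEndUnit E ι) := by
  refine (Functor.FullyFaithful.ofFullyFaithful E).homEquiv.symm.bijective.comp
    (Function.Bijective.comp (g := fun f => ι.hom ≫ f ≫ ι.inv) ?_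
      (bijective_singleFunctor_map_smul k))
  exact (ι.homCongr ι).symm.bijective

variable [HasZeroObject D] [HasShift D ℤ] [∀ n : ℤ, (shiftFunctor D n).Additive]
  [Pretriangulated D]
/-- An equivalence to the derived category of `k` which sends the unit to `k` sends the shifts of
the unit to the shifts of `k`. -/
def objShiftUnitIso (E : D ⥤ DerivedCategory (ModuleCat.{v} k))
    [E.IsEquivalence] [E.CommShift ℤ] [E.IsTriangulated] (ι : E.obj (𝟙_ D) ≅ derivedUnit k)
    (n : ℤ) : E.obj ((𝟙_ D)⟦n⟧) ≅
    (DerivedCategory.singleFunctor (ModuleCat.{v} k) (-n)).obj (ModuleCat.of k k) :=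
  (E.commShiftIso n).app (𝟙_ D) ≪≫ (shiftFunctor _ n).mapIso ι ≪≫
    ((DerivedCategory.singleFunctors (ModuleCat.{v} k)).shiftIso n (-n) 0
      (add_neg_cancel n)).app (ModuleCat.of k k)

lemma hom_unit_shift_eq_zero (E : D ⥤ DerivedCategory (ModuleCat.{v} k))
    [E.IsEquivalence] [E.CommShift ℤ] [E.IsTriangulated] (ι : E.obj (𝟙_ D) ≅ derivedUnit k)
    {n : ℤ} (hn : n ≠ 0) (a : 𝟙_ D ⟶ (𝟙_ D)⟦n⟧) : a = 0 := by
  apply E.map_injective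
  rw [E.map_zero, ← cancel_epi ι.inv, ← cancel_mono (objShiftUnitIso E ι n).hom,
    hom_singleFunctor_eq_zero k (neg_ne_zero.2 hn).symm ((ι.inv ≫ E.map a) ≫ _)]
  simp

lemma hom_shift_unit_eq_zero (E : D ⥤ DerivedCategory (ModuleCat.{v} k))
    [E.IsEquivalence] [E.CommShift ℤ] [E.IsTriangulated] (ι : E.obj (𝟙_ D) ≅ derivedUnit k)
    {n : ℤ} (hn : n ≠ 0) (a : (𝟙_ D)⟦n⟧ ⟶ 𝟙_ D) : a = 0 := by
  apply E.map_injective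
  rw [E.map_zero, ← cancel_epi (objShiftUnitIso E ι n).inv, ← cancel_mono ι.hom,
    hom_singleFunctor_eq_zero k (neg_ne_zero.2 hn) ((_ ≫ E.map a) ≫ ι.hom)]
  simp

lemma isCompactGeneratingFamily_shift_unit (E : D ⥤ DerivedCategory (ModuleCat.{v} k))
    [E.IsEquivalence] [E.CommShift ℤ] [E.IsTriangulated] (ι : E.obj (𝟙_ D) ≅ derivedUnit k)
    (h : compactObjects D (𝟙_ D)) :
    IsCompactGeneratingFamily (fun n : ULift.{v} ℤ => (𝟙_ D)⟦n.down⟧) where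
  compact n := h.shift n.down
  desuspension n := ⟨⟨n.down + (-1)⟩, ⟨(shiftFunctorAdd D n.down (-1)).app _⟩⟩
  isZero t ht := by
    have h : IsZero (E.obj t) := isZero_of_hom_singleFunctor_eq_zero k _ (fun n f => by
      obtain ⟨m, rfl⟩ : ∃ m, n = -m := ⟨-n, (neg_neg n).symm⟩
      obtain ⟨g, hg⟩ := E.map_surjective ((objShiftUnitIso E ι m).hom ≫ f)
      rw [← cancel_epi (objShiftUnitIso E ι m).hom, ← hg, ht ⟨m⟩ g, E.map_zero, comp_zero])
    rw [IsZero.iff_id_eq_zero]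
    exact E.map_injective (h.eq_of_src _ _)

end UnitOfDerivedCategory

/-! ### Serre functors over a field -/

section LinearDuality

variable {k : Type v} [Field k]
  {C : Type u₁} [Category.{v} C] [Preadditive C] [MonoidalCategory C]
  [MonoidalClosed C] [MonoidalPreadditive C] [Linear k C] [MonoidalLinear k C]
  {D : Type u₂} [Category.{v} D] [Preadditive D] [MonoidalCategory D] [Linear k D]

variable (k) in
/-- `Hom(x, y) ≅ Hom(𝟙, [x, y])`. -/
def linearCurry' (x y : C) : (x ⟶ y) ≃ₗ[k] (𝟙_ C ⟶ (ihom x).obj y) :=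
  LinearEquiv.symm
    { MonoidalClosed.curryHomEquiv'.symm with
      map_add' := fun f g => by
        change MonoidalClosed.uncurry' (f + g) =
          MonoidalClosed.uncurry' f + MonoidalClosed.uncurry' g
        simp [MonoidalClosed.uncurry', MonoidalClosed.uncurry_eq]
      map_smul' := fun c f => by
        change MonoidalClosed.uncurry' (c • f) = c • MonoidalClosed.uncurry' f
        simp [MonoidalClosed.uncurry', MonoidalClosed.uncurry_eq] }

lemma linearCurry'_apply (x y : C) (f : x ⟶ y) :
    linearCurry' k x y f = MonoidalClosed.curry ((ρ_ x).hom ≫ f) := rfl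

lemma linearCurry'_comp_left {x x' : C} (a : x ⟶ x') (y : C) (f : x' ⟶ y) :
    linearCurry' k x y (a ≫ f) = linearCurry' k x' y f ≫ (MonoidalClosed.pre a).app y := by
  rw [linearCurry'_apply, linearCurry'_apply, MonoidalClosed.curry_pre_app,
    rightUnitor_naturality_assoc]

lemma linearCurry'_comp_right (x : C) {y y' : C} (f : x ⟶ y) (b : y ⟶ y') :
    linearCurry' k x y' (f ≫ b) = linearCurry' k x y f ≫ (ihom x).map b := by
  rw [linearCurry'_apply, linearCurry'_apply, ← MonoidalClosed.curry_natural_right,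
    Category.assoc]

variable {F : D ⥤ C} [F.Monoidal] [F.Additive] [F.Linear k] {R : C ⥤ D}

variable (k) in
/-- `Hom(x, y) ≅ Hom(𝟙, R [x, y])`, for `R` a right adjoint of a monoidal functor. -/
def homRichHom (adj : F ⊣ R) (x y : C) : (x ⟶ y) ≃ₗ[k] (𝟙_ D ⟶ richHom R x y) :=
  (linearCurry' k x y ≪≫ₗ Linear.homCongr k (Functor.Monoidal.εIso F) (Iso.refl _)) ≪≫ₗ
    LinearEquiv.symm
      { (adj.homEquiv (𝟙_ D) ((ihom x).obj y)).symm with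
        map_add' := fun f g => by
          simp [Adjunction.homEquiv_counit, F.map_add]
        map_smul' := fun c f => by
          simp [Adjunction.homEquiv_counit, F.map_smul] }

lemma homRichHom_apply (adj : F ⊣ R) (x y : C) (f : x ⟶ y) :
    homRichHom k adj x y f = adj.homEquiv _ _ (Functor.OplaxMonoidal.η F ≫ linearCurry' k x y f) :=
  congrArg (adj.homEquiv _ _) (Category.comp_id _)

lemma homRichHom_comp_left (adj : F ⊣ R) {x x' : C} (a : x ⟶ x') (y : C) (f : x' ⟶ y) :
    homRichHom k adj x y (a ≫ f) =
      homRichHom k adj x' y f ≫ R.map ((MonoidalClosed.pre a).app y) := by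
  rw [homRichHom_apply, homRichHom_apply, linearCurry'_comp_left, ← Category.assoc,
    Adjunction.homEquiv_naturality_right]

lemma homRichHom_comp_right (adj : F ⊣ R) (x : C) {y y' : C} (f : x ⟶ y) (b : y ⟶ y') :
    homRichHom k adj x y' (f ≫ b) =
      homRichHom k adj x y f ≫ R.map ((ihom x).map b) := by
  rw [homRichHom_apply, homRichHom_apply, linearCurry'_comp_right, ← Category.assoc,
    Adjunction.homEquiv_naturality_right]

/-- The duality `Hom(d, 𝟙) ≅ Hom_k(Hom(𝟙, d), k)`, if the pairing which is given by composition and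
a functional on `End(𝟙)` is perfect. -/
def homUnitEquivDual (u : Module.Dual k (𝟙_ D ⟶ 𝟙_ D)) (d : D)
    (hu : Function.Bijective (fun a : d ⟶ 𝟙_ D => u ∘ₗ Linear.rightComp k (𝟙_ D) a)) :
    (d ⟶ 𝟙_ D) ≃ₗ[k] Module.Dual k (𝟙_ D ⟶ d) :=
  LinearEquiv.ofBijective
    { toFun := fun a => u ∘ₗ Linear.rightComp k (𝟙_ D) a
      map_add' := fun a b => by ext; simp
      map_smul' := fun c a => by ext; simp } hu

lemma homUnitEquivDual_symm_comp (u : Module.Dual k (𝟙_ D ⟶ 𝟙_ D))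
    (hu : ∀ d : D, Function.Bijective (fun a : d ⟶ 𝟙_ D => u ∘ₗ Linear.rightComp k (𝟙_ D) a))
    {d d' : D} (p : d ⟶ d') (ψ : Module.Dual k (𝟙_ D ⟶ d')) :
    (homUnitEquivDual u d (hu d)).symm (ψ ∘ₗ Linear.rightComp k (𝟙_ D) p) =
      p ≫ (homUnitEquivDual u d' (hu d')).symm ψ := by
  rw [LinearEquiv.symm_apply_eq]
  obtain ⟨a, rfl⟩ := (homUnitEquivDual u d' (hu d')).surjective ψ
  rw [LinearEquiv.symm_apply_apply]
  exact LinearMap.ext fun b => congrArg u (Category.assoc b p a)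

/-- A vector space which is isomorphic to its bidual is finite-dimensional. -/
lemma finite_of_linearEquiv_dual_dual {V : Type v} [AddCommGroup V] [Module k V]
    (e : V ≃ₗ[k] Module.Dual k (Module.Dual k V)) : Module.Finite k V := by
  rw [← Module.rank_lt_aleph0_iff]
  by_contra! h
  have h' := rank_lt_rank_dual h
  -- Dualizing an infinite-dimensional space strictly raises the rank, and does so again the second
  -- time.
  exact (h'.trans (rank_lt_rank_dual (h.trans h'.le))).ne e.rank_eq

/-- Applying the duality to `d` and to its dual, and using that a rigid `d` is its own double dual,
identifies `Hom(𝟙, d)` with its bidual. -/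
lemma IsRigidObject.finite_hom_unit [MonoidalPreadditive D] [MonoidalLinear k D]
    [SymmetricCategory D] [MonoidalClosed D] {d : D} (hd : IsRigidObject d)
    (u : Module.Dual k (𝟙_ D ⟶ 𝟙_ D))
    (hu : ∀ d : D, Function.Bijective (fun a : d ⟶ 𝟙_ D => u ∘ₗ Linear.rightComp k (𝟙_ D) a)) :
    Module.Finite k (𝟙_ D ⟶ d) := by
  let e (d : D) : (𝟙_ D ⟶ tensorDual d) ≃ₗ[k] Module.Dual k (𝟙_ D ⟶ d) :=
    (linearCurry' k d (𝟙_ D)).symm ≪≫ₗ homUnitEquivDual u d (hu d)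
  have := isIso_doubleHomMap hd (𝟙_ D) (𝟙_ D)
  let i : d ≅ tensorDual (tensorDual d) := (ρ_ d).symm ≪≫
    whiskerLeftIso d (MonoidalClosed.unitNatIso.app (𝟙_ D)) ≪≫
      asIso (doubleHomMap d (𝟙_ D) (𝟙_ D))
  exact finite_of_linearEquiv_dual_dual
    (Linear.homCongr k (Iso.refl _) i ≪≫ₗ e (tensorDual d) ≪≫ₗ (e d).symm.dualMap)

end LinearDuality

/-! ### From relative duality to duality of Hom-spaces -/

section SerreFunctor

variable {k : Type v} [Field k]
  {C : Type u₁} [Category.{v} C] [Preadditive C] [MonoidalCategory C]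
  [MonoidalClosed C] [MonoidalPreadditive C] [Linear k C] [MonoidalLinear k C]
  {D : Type u₂} [Category.{v} D] [Preadditive D] [MonoidalCategory D]
  [MonoidalClosed D] [MonoidalPreadditive D] [Linear k D] [MonoidalLinear k D]
  {F : D ⥤ C} [F.Monoidal] [F.Additive] [F.Linear k] {R : C ⥤ D}

/-- The duality isomorphism on Hom-spaces which is induced by an isomorphism
`[R [x, y], 𝟙] ≅ R [y, z]`. -/
def serreDuality (adj : F ⊣ R) (u : Module.Dual k (𝟙_ D ⟶ 𝟙_ D))
    (hu : ∀ d : D, Function.Bijective (fun a : d ⟶ 𝟙_ D => u ∘ₗ Linear.rightComp k (𝟙_ D) a))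
    {x y z : C} (s : tensorDual (richHom R x y) ≅ richHom R y z) :
    Module.Dual k (x ⟶ y) ≃ₗ[k] (y ⟶ z) :=
  (homRichHom k adj x y).symm.dualMap ≪≫ₗ (homUnitEquivDual u _ (hu (richHom R x y))).symm ≪≫ₗ
    linearCurry' k (richHom R x y) (𝟙_ D) ≪≫ₗ Linear.homCongr k (Iso.refl _) s ≪≫ₗ
      (homRichHom k adj y z).symm

lemma homRichHom_serreDuality (adj : F ⊣ R) (u : Module.Dual k (𝟙_ D ⟶ 𝟙_ D))
    (hu : ∀ d : D, Function.Bijective (fun a : d ⟶ 𝟙_ D => u ∘ₗ Linear.rightComp k (𝟙_ D) a))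
    {x y z : C} (s : tensorDual (richHom R x y) ≅ richHom R y z) (φ : Module.Dual k (x ⟶ y)) :
    homRichHom k adj y z (serreDuality adj u hu s φ) =
      linearCurry' k (richHom R x y) (𝟙_ D) ((homUnitEquivDual u _ (hu (richHom R x y))).symm
        (φ ∘ₗ (homRichHom k adj x y).symm.toLinearMap)) ≫ s.hom :=
  ((homRichHom k adj y z).apply_symm_apply _).trans
    (congrArg (· ≫ s.hom) (Category.id_comp _))

/-- After applying `homRichHom` the equation lives in `D`; all other factors of the duality are
natural, so only the square `h` for `s` and `s'` remains. -/
lemma serreDuality_naturality_left (adj : F ⊣ R) (u : Module.Dual k (𝟙_ D ⟶ 𝟙_ D))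
    (hu : ∀ d : D, Function.Bijective (fun a : d ⟶ 𝟙_ D => u ∘ₗ Linear.rightComp k (𝟙_ D) a))
    {x x' y z z' : C} (s : tensorDual (richHom R x y) ≅ richHom R y z)
    (s' : tensorDual (richHom R x' y) ≅ richHom R y z') (a : x ⟶ x') (c : z ⟶ z')
    (h : (MonoidalClosed.pre (R.map ((MonoidalClosed.pre a).app y))).app (𝟙_ D) ≫ s'.hom =
      s.hom ≫ R.map ((ihom y).map c)) (φ : Module.Dual k (x ⟶ y)) :
    serreDuality adj u hu s' (φ ∘ₗ Linear.leftComp k y a) = serreDuality adj u hu s φ ≫ c := by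
  apply (homRichHom k adj y z').injective
  have h₁ : (φ ∘ₗ Linear.leftComp k y a) ∘ₗ (homRichHom k adj x' y).symm.toLinearMap =
      (φ ∘ₗ (homRichHom k adj x y).symm.toLinearMap) ∘ₗ
        Linear.rightComp k _ (R.map ((MonoidalClosed.pre a).app y)) := by
    refine LinearMap.ext fun b => congrArg φ ?_
    obtain ⟨f, rfl⟩ := (homRichHom k adj x' y).surjective b
    change a ≫ (homRichHom k adj x' y).symm (homRichHom k adj x' y f) =
      (homRichHom k adj x y).symm (homRichHom k adj x' y f ≫ R.map ((MonoidalClosed.pre a).app y))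
    rw [← homRichHom_comp_left, LinearEquiv.symm_apply_apply, LinearEquiv.symm_apply_apply]
  rw [homRichHom_comp_right, homRichHom_serreDuality, homRichHom_serreDuality, h₁,
    homUnitEquivDual_symm_comp u hu, linearCurry'_comp_left, Category.assoc, Category.assoc, h]

lemma serreDuality_naturality_right (adj : F ⊣ R) (u : Module.Dual k (𝟙_ D ⟶ 𝟙_ D))
    (hu : ∀ d : D, Function.Bijective (fun a : d ⟶ 𝟙_ D => u ∘ₗ Linear.rightComp k (𝟙_ D) a))
    {x y y' z : C} (s : tensorDual (richHom R x y) ≅ richHom R y z)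
    (s' : tensorDual (richHom R x y') ≅ richHom R y' z) (b : y ⟶ y')
    (h : (MonoidalClosed.pre (R.map ((ihom x).map b))).app (𝟙_ D) ≫ s.hom =
      s'.hom ≫ R.map ((MonoidalClosed.pre b).app z)) (φ : Module.Dual k (x ⟶ y')) :
    serreDuality adj u hu s (φ ∘ₗ Linear.rightComp k x b) = b ≫ serreDuality adj u hu s' φ := by
  apply (homRichHom k adj y z).injective
  have h₁ : (φ ∘ₗ Linear.rightComp k x b) ∘ₗ (homRichHom k adj x y).symm.toLinearMap =
      (φ ∘ₗ (homRichHom k adj x y').symm.toLinearMap) ∘ₗ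
        Linear.rightComp k _ (R.map ((ihom x).map b)) := by
    refine LinearMap.ext fun c => congrArg φ ?_
    obtain ⟨f, rfl⟩ := (homRichHom k adj x y).surjective c
    change (homRichHom k adj x y).symm (homRichHom k adj x y f) ≫ b =
      (homRichHom k adj x y').symm (homRichHom k adj x y f ≫ R.map ((ihom x).map b))
    rw [← homRichHom_comp_right, LinearEquiv.symm_apply_apply, LinearEquiv.symm_apply_apply]
  rw [homRichHom_comp_left, homRichHom_serreDuality, homRichHom_serreDuality, h₁,
    homUnitEquivDual_symm_comp u hu, linearCurry'_comp_left, Category.assoc, Category.assoc, h]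

/-- A relative Serre duality isomorphism induces a Serre functor, if `Hom(-, 𝟙)` is the dual of
`Hom(𝟙, -)`. -/
def SerreFunctor.ofRelative [SymmetricCategory C]
    [SymmetricCategory D] [RigidlyCompactlyGenerated C] [RigidlyCompactlyGenerated D]
    (adj : F ⊣ R) (u : Module.Dual k (𝟙_ D ⟶ 𝟙_ D))
    (hu : ∀ d : D, Function.Bijective (fun a : d ⟶ 𝟙_ D => u ∘ₗ Linear.rightComp k (𝟙_ D) a))
    {w : C} (hw : ∀ x : C, compactObjects C x → compactObjects C (x ⊗ w))
    (T : RelativeSerreFunctor R (tensorOnCompacts w hw)) :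
    SerreFunctor k (tensorOnCompacts w hw) where
  isEquivalence := T.isEquivalence
  additive := ⟨fun {_ _ f g} => (compactObjects C).hom_ext
    (MonoidalPreadditive.add_whiskerRight f.hom g.hom)⟩
  linear := ⟨fun f c => (compactObjects C).hom_ext
    (MonoidalLinear.smul_whiskerRight c f.hom w)⟩
  finite x y := by
    have := (T.richHom_compact x y).isRigidObject.finite_hom_unit u hu
    exact Module.Finite.equiv ((InducedCategory.homLinearEquiv ≪≫ₗ
      homRichHom k adj x.obj y.obj).symm)
  σ x y := InducedCategory.homLinearEquiv.symm.dualMap ≪≫ₗ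
    serreDuality adj u hu ((T.σ.app x).app (op y)) ≪≫ₗ InducedCategory.homLinearEquiv.symm
  naturality_left {x x'} a y φ := by
    have h := serreDuality_naturality_left adj u hu ((T.σ.app x).app (op y))
      ((T.σ.app x').app (op y)) a.hom (a.hom ▷ w)
      (NatTrans.congr_app (T.σ.hom.naturality a) (op y))
      (φ ∘ₗ (InducedCategory.homLinearEquiv (R := k)).symm.toLinearMap)
    exact (compactObjects C).hom_ext h
  naturality_right x {y y'} b φ := by
    have h := serreDuality_naturality_right adj u hu ((T.σ.app x).app (op y))
      ((T.σ.app x).app (op y')) b.hom ((T.σ.hom.app x).naturality b.op)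
      (φ ∘ₗ (InducedCategory.homLinearEquiv (R := k)).symm.toLinearMap)
    exact (compactObjects C).hom_ext h

end SerreFunctor

section

variable {k : Type v} [Field k] [HasDerivedCategory.{w} (ModuleCat.{v} k)]
  {D : Type u₂} [Category.{v} D] [Preadditive D] [HasZeroObject D] [HasShift D ℤ]
  [∀ n : ℤ, (shiftFunctor D n).Additive] [Pretriangulated D]
  [MonoidalCategory D] [SymmetricCategory D] [MonoidalClosed D] [MonoidalPreadditive D]
  [RigidlyCompactlyGenerated D]

/-- In the derived category of a field `k`, the unit represents the dual of the functor
`Hom(𝟙, -)`. -/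
lemma exists_perfect_functional (E : D ⥤ DerivedCategory (ModuleCat.{v} k)) [E.IsEquivalence]
    [E.CommShift ℤ] [E.IsTriangulated] (ι : E.obj (𝟙_ D) ≅ derivedUnit k) :
    let _ := unitLinear (scalarsToEndUnit E ι)
    ∃ u : Module.Dual k (𝟙_ D ⟶ 𝟙_ D), ∀ d : D,
      Function.Bijective (fun a : d ⟶ 𝟙_ D => u ∘ₗ Linear.rightComp k (𝟙_ D) a) := by
  intro _
  have := (RigidlyCompactlyGenerated.compactlyGenerated (C := D)).1
  have h : Function.Bijective (fun a : k => a • 𝟙 (𝟙_ D)) := by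
    rw [show (fun a : k => a • 𝟙 (𝟙_ D)) = fun a => scalarsToEndUnit E ι a from
      funext (unitLinear_smul_id (scalarsToEndUnit E ι))]
    exact bijective_scalarsToEndUnit E ι
  -- The perfect functional is the inverse of `k ≅ End(𝟙)`.
  let e : k ≃ₗ[k] (𝟙_ D ⟶ 𝟙_ D) := LinearEquiv.ofBijective (LinearMap.toSpanSingleton k _ (𝟙 _)) h
  exact ⟨_, bijective_dual_comp
    (isCompactGeneratingFamily_shift_unit E ι (isRigidObject_unit D).compactObjects)
    (fun n hn => hom_unit_shift_eq_zero E ι hn) (fun n hn => hom_shift_unit_eq_zero E ι hn)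
    e.symm ((LinearEquiv.symm_apply_eq e).2 (one_smul k (𝟙 (𝟙_ D))).symm)⟩

end

end

theorem mainTheorem5
    {C : Type u₁} [Category.{v} C] [Preadditive C] [HasZeroObject C] [HasShift C ℤ]
    [∀ n : ℤ, (shiftFunctor C n).Additive] [Pretriangulated C] [IsTriangulated C]
    [MonoidalCategory C] [SymmetricCategory C] [MonoidalClosed C] [MonoidalPreadditive C]
    [TensorTriangulated C] [RigidlyCompactlyGenerated C]
    {D : Type u₂} [Category.{v} D] [Preadditive D] [HasZeroObject D] [HasShift D ℤ]
    [∀ n : ℤ, (shiftFunctor D n).Additive] [Pretriangulated D] [IsTriangulated D]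
    [MonoidalCategory D] [SymmetricCategory D] [MonoidalClosed D] [MonoidalPreadditive D]
    [TensorTriangulated D] [RigidlyCompactlyGenerated D]
    -- `F = f^*` is a tensor-exact functor which preserves coproducts
    (F : D ⥤ C) [F.Braided] [F.CommShift ℤ] [F.IsTriangulated]
    (hF : ∀ J : Type v, PreservesColimitsOfShape (Discrete J) F) :
    -- the adjoints `f^* ⊣ f_* ⊣ f^{(1)}` exist
    (∃ (R : C ⥤ D) (G : D ⥤ C), Nonempty (F ⊣ R) ∧ Nonempty (R ⊣ G)) ∧
    -- and for any choice of them, with `R = f_*`, `G = f^{(1)}` and `ω = G 𝟙`: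
    ∀ (R : C ⥤ D) (G : D ⥤ C) (adj : F ⊣ R) (adj' : R ⊣ G),
      -- the canonical isomorphism `[R [x, y], 𝟙] ≅ R [y, x ⊗ ω]`, for `x ∈ Cᶜ` and `y ∈ C`
      (∃! σ : (compactObjects C).ι ⋙ dualRichHom R ≅
          richHomInto R ((compactObjects C).ι ⋙ tensorRight (dualizingObject G)),
        ∀ (x : CompactSubcategory C) (y : C),
          IsCanonicalSerreMap adj adj' x.obj y ((σ.hom.app x).app (op y))) ∧
      (WirthmuellerSituation F R G →
        ∃ hω : ∀ x : C, compactObjects C x → compactObjects C (x ⊗ dualizingObject G),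
          -- the relative Serre functor
          (∃ T : RelativeSerreFunctor R (tensorOnCompacts (dualizingObject G) hω),
            ∀ x y : CompactSubcategory C,
              IsCanonicalSerreMap adj adj' x.obj y.obj ((T.σ.hom.app x).app (op y))) ∧
          -- the Serre functor over a field
          (∀ (k : Type v) [Field k] [HasDerivedCategory.{w} (ModuleCat.{v} k)]
            (E : D ⥤ DerivedCategory (ModuleCat.{v} k)) [E.IsEquivalence]
            [E.CommShift ℤ] [E.IsTriangulated] (ι : E.obj (𝟙_ D) ≅ derivedUnit k),
            letI : Linear k C := inducedLinear F E ι
            Nonempty (SerreFunctor k (tensorOnCompacts (dualizingObject G) hω)))) := by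
  refine ⟨exists_adjoints F hF, fun R G adj adj' => ?_⟩
  have duality := existsUnique_relativeSerreDuality adj adj' (fun _ h => h.isRigidObject)
    (isIso_dualizingMap adj adj')
  refine ⟨duality, fun hW => ?_⟩
  obtain ⟨hR, hω⟩ := hW.compact_and_invertible hF adj'
  obtain ⟨σ, hσ, -⟩ := duality
  -- An invertible `ω` is rigid, so tensoring with it keeps compact objects compact.
  let T := RelativeSerreFunctor.ofIso hR hω (fun x hx => hx.tensor hω.isRigidObject) σ
  refine ⟨_, ⟨T, fun x y => hσ x y.obj⟩, fun k _ _ E _ _ _ ι => ?_⟩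
  let _ : Linear k D := unitLinear (scalarsToEndUnit E ι)
  let _ : Linear k C := inducedLinear F E ι
  have : MonoidalLinear k D := monoidalLinear_unitLinear (scalarsToEndUnit E ι)
  -- `inducedLinear` and this `unitLinear` differ only in how the composite of ring morphisms is
  -- bracketed.
  have : MonoidalLinear k C :=
    monoidalLinear_unitLinear ((endUnitMap F).comp (scalarsToEndUnit E ι))
  have : F.Linear k := linear_unitLinear F (scalarsToEndUnit E ι)
  obtain ⟨u, hu⟩ := exists_perfect_functional E ι
  exact ⟨SerreFunctor.ofRelative adj u hu _ T⟩
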